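/- Let $k$ be a field and let $A=\bigoplus_{i\ge 0}A^i$ be a connected DG $k$-algebra: a graded $k$-algebra with $A^0=k$ and a $k$-linear differential $\partial_A$ of degree $1$ such that $\partial_A^2=0$ and $\partial_A(ab)=\partial_A(a)b+(-1)^{|a|}a\,\partial_A(b)$ for homogeneous $a$ and all $b$. Let $k=A/A^{\ge 1}$ be its trivial left DG module, and let $H(A)$ be its cohomology algebra, a connected graded algebra. A left DG $A$-module is a $\mathbb{Z}$-graded left module $M$ over the graded algebra underlying $A$, with a $k$-linear differential $\partial_M$ of degree $1$ such that $\partial_M^2=0$ and $\partial_M(am)=\partial_A(a)m+(-1)^{|a|}a\,\partial_M(m)$. It is called DG free if it has a basis over the graded algebra underlying $A$ that consists of homogeneous cocycles. A semi-free filtration of a DG module $F$ is a sequence of DG submodules $0=F(-1)\subseteq F(0)\subseteq F(1)\subseteq\cdots$ with union $F$ such that every $F(n)/F(n-1)$ is DG free; $F$ is semi-free if it has such a filtration. The filtration is strictly increasing if $F(i-1)\ne F(i)$ whenever $F(i-1)\neq F$, $i\ge 0$, and it has length $n$ if $F(n)=F$ and $F(n-1)\ne F$ (the zero module is given length $0$).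 The DG free class of $F$ is the infimum in $\mathbb{N}\cup\{\infty\}$ (with $0\in\mathbb{N}$) of the lengths of its strictly increasing semi-free filtrations. The cone length $\mathrm{cl}_AM$ of a DG module $M$ is the infimum of the DG free classes of all semi-free $F$ that admit a quasi-isomorphism $F\to M$. The left global dimension of $A$ is $$l.\mathrm{Gl.dim}\,A=\sup\{\mathrm{cl}_AM \mid M \text{ a left DG } A\text{-module}\}.$$ The global dimension $\mathrm{gl.dim}\,H(A)$ of the graded algebra $H(A)$ is the supremum of the projective dimensions of all $\mathbb{Z}$-graded left $H(A)$-modules, in the category of graded modules and degree-preserving $H(A)$-linear maps. If $\mathrm{gl.dim}\,H(A)=2$, then $$l.\mathrm{Gl.dim}\,A=\mathrm{cl}_A k=2.$$ -/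

import Mathlib

universe u

/-! ### Graded algebras and graded modules -/

/-- A graded `k`-algebra `B = ⨁_{i ≥ 0} B^i` (associative, unital, not assumed commutative). -/
structure GradedAlg (k : Type u) [Field k] where
  carrier : Type u
  [ring : Ring carrier]
  [algebra : Algebra k carrier]
  deg : ℕ → Submodule k carrier
  [graded : GradedAlgebra deg]

attribute [instance] GradedAlg.ring GradedAlg.algebra GradedAlg.graded

/-- A graded algebra `B` is connected if the structure map `k → B^0` is bijective. -/
def GradedAlg.IsConnected {k : Type u} [Field k] (B : GradedAlg k) : Prop :=
  Function.Bijective (algebraMap k (B.deg 0))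

/-- A `ℤ`-graded left module over a graded algebra. -/
structure GradedMod {k : Type u} [Field k] (B : GradedAlg k) where
  carrier : Type u
  [addCommGroup : AddCommGroup carrier]
  [kmodule : Module k carrier]
  [module : Module B.carrier carrier]
  [tower : IsScalarTower k B.carrier carrier]
  deg : ℤ → Submodule k carrier
  [decomp : DirectSum.Decomposition deg]
  smul_mem : ∀ {i : ℕ} {j : ℤ} {a : B.carrier} {m : carrier},
    a ∈ B.deg i → m ∈ deg j → a • m ∈ deg (i + j)

attribute [instance] GradedMod.addCommGroup GradedMod.kmodule GradedMod.module GradedMod.tower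
  GradedMod.decomp

/-- A morphism of graded modules: a `B`-linear map that preserves degrees. -/
structure GradedMod.Hom {k : Type u} [Field k] {B : GradedAlg k} (M N : GradedMod B) where
  toLin : M.carrier →ₗ[B.carrier] N.carrier
  map_deg : ∀ (i : ℤ) (m : M.carrier), m ∈ M.deg i → toLin m ∈ N.deg i

/-- Projective objects of the category of graded modules, through the lifting property against
surjective morphisms of graded modules. -/
def GradedMod.IsProjective {k : Type u} [Field k] {B : GradedAlg k} (P : GradedMod B) : Prop :=
  ∀ (M N : GradedMod B) (g : GradedMod.Hom M N) (f : GradedMod.Hom P N),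
    Function.Surjective g.toLin → ∃ h : GradedMod.Hom P M, ∀ x, g.toLin (h.toLin x) = f.toLin x

/-- `N` has a projective resolution `0 → P_n → ⋯ → P_1 → P_0 → N → 0` in the category of graded
modules (written as an infinite resolution with `P_i = 0` for `i > n`). -/
def GradedMod.HasProjResolution {k : Type u} [Field k] {B : GradedAlg k} (N : GradedMod B)
    (n : ℕ) : Prop :=
  ∃ (P : ℕ → GradedMod B) (δ : ∀ i, GradedMod.Hom (P (i + 1)) (P i)) (ε : GradedMod.Hom (P 0) N),
    (∀ i, (P i).IsProjective) ∧
    (∀ i, n < i → Subsingleton (P i).carrier) ∧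
    Function.Surjective ε.toLin ∧
    Function.Exact (δ 0).toLin ε.toLin ∧
    ∀ i, Function.Exact (δ (i + 1)).toLin (δ i).toLin

/-- The projective dimension of a graded module, in `ℕ ∪ {∞}`. -/
noncomputable def GradedMod.projDim {k : Type u} [Field k] {B : GradedAlg k}
    (N : GradedMod B) : ℕ∞ :=
  ⨅ (n : ℕ) (_ : N.HasProjResolution n), (n : ℕ∞)

/-- The (left) global dimension of a graded algebra: the supremum of the projective dimensions of
its graded left modules. -/
noncomputable def GradedAlg.globalDim {k : Type u} [Field k] (B : GradedAlg k) : ℕ∞ :=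
  ⨆ N : GradedMod B, N.projDim

/-! ### DG algebras and their cohomology algebras -/

/-- A (nonnegatively graded, cochain) differential graded `k`-algebra. -/
structure DGAlg (k : Type u) [Field k] extends GradedAlg k where
  d : carrier →ₗ[k] carrier
  d_mem : ∀ {i : ℕ} {a : carrier}, a ∈ deg i → d a ∈ deg (i + 1)
  d_d : ∀ a, d (d a) = 0
  leibniz : ∀ {i : ℕ} {a : carrier} (b : carrier), a ∈ deg i →
    d (a * b) = d a * b + (-1 : k) ^ i • (a * d b)

namespace DGAlg

variable {k : Type u} [Field k] (A : DGAlg k)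

/-- The projection of `A` onto its component of degree `i`. -/
noncomputable def comp (i : ℕ) : A.carrier →ₗ[k] A.carrier := GradedAlgebra.proj A.deg i

lemma comp_mem (i : ℕ) (a : A.carrier) : A.comp i a ∈ A.deg i := by
  simp [comp, GradedAlgebra.proj_apply]

lemma comp_of_mem {i : ℕ} {a : A.carrier} (h : a ∈ A.deg i) : A.comp i a = a := by
  simp [comp, GradedAlgebra.proj_apply, DirectSum.decompose_of_mem_same _ h]

lemma comp_of_mem_ne {i j : ℕ} {a : A.carrier} (h : a ∈ A.deg i) (hij : i ≠ j) :
    A.comp j a = 0 := by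
  simp [comp, GradedAlgebra.proj_apply, DirectSum.decompose_of_mem_ne _ h hij]

lemma sum_comp (a : A.carrier) : ∃ s : Finset ℕ, ∑ i ∈ s, A.comp i a = a := by
  classical
  exact ⟨_, DirectSum.sum_support_decompose A.deg a⟩

lemma comp_succ_d (i : ℕ) (a : A.carrier) : A.comp (i + 1) (A.d a) = A.d (A.comp i a) := by
  induction a using DirectSum.Decomposition.inductionOn A.deg with
  | zero => simp
  | @homogeneous j m =>
    by_cases h : j = i
    · subst h
      rw [A.comp_of_mem m.2, A.comp_of_mem (A.d_mem m.2)]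
    · rw [A.comp_of_mem_ne m.2 h, A.comp_of_mem_ne (A.d_mem m.2) (by omega), map_zero]
  | add x y hx hy => simp [hx, hy]

lemma comp_zero_d (a : A.carrier) : A.comp 0 (A.d a) = 0 := by
  induction a using DirectSum.Decomposition.inductionOn A.deg with
  | zero => simp
  | @homogeneous j m => exact A.comp_of_mem_ne (A.d_mem m.2) (by omega)
  | add x y hx hy => simp [hx, hy]

lemma d_comp_eq_zero {a : A.carrier} (h : A.d a = 0) (i : ℕ) : A.d (A.comp i a) = 0 := by
  rw [← comp_succ_d, h, map_zero]

lemma d_one : A.d 1 = 0 := by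
  have h := A.leibniz (i := 0) (a := 1) 1 SetLike.GradedOne.one_mem
  simpa using h

lemma d_cocycle_mul {a : A.carrier} (ha : A.d a = 0) (b : A.carrier) :
    ∃ c, A.d (a * b) = a * A.d b + c ∧ (A.d b = 0 → c = 0) ∧ ∃ e, a * A.d b = A.d e := by
  obtain ⟨s, hs⟩ := A.sum_comp a
  have key : ∀ i, A.d (A.comp i a * b) = (-1 : k) ^ i • (A.comp i a * A.d b) := fun i => by
    rw [A.leibniz b (A.comp_mem i a), A.d_comp_eq_zero ha, zero_mul, zero_add]
  have h1 : A.d (a * b) = ∑ i ∈ s, (-1 : k) ^ i • (A.comp i a * A.d b) := by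
    conv_lhs => rw [← hs]
    rw [Finset.sum_mul, map_sum]
    exact Finset.sum_congr rfl fun i _ => key i
  refine ⟨A.d (a * b) - a * A.d b, by abel, fun hb => by simp [h1, hb],
    ∑ i ∈ s, (-1 : k) ^ i • (A.comp i a * b), ?_⟩
  rw [map_sum]
  conv_lhs => rw [← hs]
  rw [Finset.sum_mul]
  refine Finset.sum_congr rfl fun i _ => ?_
  rw [map_smul, key, smul_smul, ← mul_pow]
  simp

lemma d_mul_cocycle {b : A.carrier} (hb : A.d b = 0) (a : A.carrier) :
    A.d (a * b) = A.d a * b := by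
  induction a using DirectSum.Decomposition.inductionOn A.deg with
  | zero => simp
  | homogeneous m => simp [A.leibniz b m.2, hb]
  | add x y hx hy => simp [hx, hy, add_mul]

/-- The algebra `Z(A)` of cocycles. -/
def cocycles : Subalgebra k A.carrier where
  carrier := {a | A.d a = 0}
  mul_mem' {a b} ha hb := by
    have ha' : A.d a = 0 := ha
    have hb' : A.d b = 0 := hb
    simp [A.d_mul_cocycle hb', ha']
  add_mem' {a b} ha hb := by
    have ha' : A.d a = 0 := ha
    have hb' : A.d b = 0 := hb
    simp [ha', hb']
  algebraMap_mem' r := by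
    simp [Algebra.algebraMap_eq_smul_one, A.d_one]

lemma mem_cocycles {a : A.carrier} : a ∈ A.cocycles ↔ A.d a = 0 := Iff.rfl

/-- The ideal `B(A)` of coboundaries in the algebra of cocycles. -/
def coboundaries : Ideal A.cocycles where
  carrier := {z | ∃ a, A.d a = z}
  zero_mem' := ⟨0, by simp⟩
  add_mem' := by
    rintro x y ⟨a, ha⟩ ⟨b, hb⟩
    exact ⟨a + b, by simp [ha, hb]⟩
  smul_mem' := by
    rintro z x ⟨a, ha⟩
    obtain ⟨c, -, -, e, he⟩ := A.d_cocycle_mul z.2 a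
    exact ⟨e, by rw [← he, ha]; rfl⟩

lemma mem_coboundaries {z : A.cocycles} : z ∈ A.coboundaries ↔ ∃ a, A.d a = z := Iff.rfl

instance : A.coboundaries.IsTwoSided where
  mul_mem_of_left {x} z hx := by
    obtain ⟨a, ha⟩ := hx
    exact ⟨a * z, by rw [A.d_mul_cocycle z.2, ha]; rfl⟩

/-- The underlying algebra `Z(A) / B(A)` of the cohomology algebra. -/
def CohomologyCarrier : Type u := A.cocycles ⧸ A.coboundaries

instance : Ring A.CohomologyCarrier := inferInstanceAs (Ring (A.cocycles ⧸ A.coboundaries))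

instance : Algebra k A.CohomologyCarrier :=
  inferInstanceAs (Algebra k (A.cocycles ⧸ A.coboundaries))

/-- The class of a cocycle. -/
def cls : A.cocycles →ₐ[k] A.CohomologyCarrier := Ideal.Quotient.mkₐ k A.coboundaries

lemma cls_surjective : Function.Surjective A.cls := Ideal.Quotient.mk_surjective

lemma cls_eq_zero_iff {z : A.cocycles} : A.cls z = 0 ↔ z ∈ A.coboundaries :=
  Ideal.Quotient.eq_zero_iff_mem

/-- `H^i(A)`: the classes of the cocycles of degree `i`. -/
def cohomologyDeg (i : ℕ) : Submodule k A.CohomologyCarrier :=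
  ((A.deg i).comap A.cocycles.val.toLinearMap).map A.cls.toLinearMap

lemma mem_cohomologyDeg {i : ℕ} {x : A.CohomologyCarrier} : x ∈ A.cohomologyDeg i ↔
    ∃ z : A.cocycles, (z : A.carrier) ∈ A.deg i ∧ A.cls z = x := Iff.rfl

/-- The projection of a cocycle onto its component of degree `i`. -/
noncomputable def cocyclesComp (i : ℕ) : A.cocycles →ₗ[k] A.cocycles where
  toFun z := ⟨A.comp i z, A.d_comp_eq_zero z.2 i⟩
  map_add' x y := by ext; simp
  map_smul' r x := by ext; simp

lemma cocyclesComp_mem_coboundaries (i : ℕ) {z : A.cocycles} (hz : z ∈ A.coboundaries) :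
    A.cocyclesComp i z ∈ A.coboundaries := by
  obtain ⟨a, ha⟩ := hz
  cases i with
  | zero => exact ⟨0, by simp [cocyclesComp, ← ha, A.comp_zero_d]⟩
  | succ i => exact ⟨A.comp i a, by simp [cocyclesComp, ← ha, A.comp_succ_d]⟩

lemma cohomology_isInternal : DirectSum.IsInternal A.cohomologyDeg := by
  classical
  constructor
  · rw [injective_iff_map_eq_zero]
    intro x hx
    ext i
    choose z hz hzx using fun i => A.mem_cohomologyDeg.1 (x i).2
    rw [DirectSum.coeAddMonoidHom_eq_dfinsuppSum, DFinsupp.sum] at hx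
    have h1 : (∑ j ∈ DFinsupp.support x, z j) ∈ A.coboundaries := by
      rw [← A.cls_eq_zero_iff, map_sum, ← hx]
      exact Finset.sum_congr rfl fun j _ => hzx j
    have h2 := A.cocyclesComp_mem_coboundaries i h1
    have h3 : ∀ j, A.cocyclesComp i (z j) = if j = i then z j else 0 := fun j => by
      ext
      split_ifs with h
      · subst h; exact A.comp_of_mem (hz j)
      · exact A.comp_of_mem_ne (hz j) h
    simp only [map_sum, h3, Finset.sum_ite_eq'] at h2
    split_ifs at h2 with h
    · rw [← hzx i, A.cls_eq_zero_iff.2 h2, DirectSum.zero_apply]; rfl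
    · exact congrArg Subtype.val (DFinsupp.notMem_support_iff.1 h)
  · intro x
    obtain ⟨z, rfl⟩ := A.cls_surjective x
    obtain ⟨s, hs⟩ := A.sum_comp z
    refine ⟨∑ i ∈ s, DirectSum.of (fun i => A.cohomologyDeg i) i
      ⟨A.cls (A.cocyclesComp i z), A.cocyclesComp i z, A.comp_mem i z, rfl⟩, ?_⟩
    rw [map_sum]
    simp only [DirectSum.coeAddMonoidHom_of]
    rw [← map_sum]
    congr 1
    ext
    rw [AddSubmonoidClass.coe_finsetSum]
    exact hs

noncomputable instance : GradedAlgebra A.cohomologyDeg where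
  one_mem := ⟨1, SetLike.GradedOne.one_mem (A := A.deg), map_one A.cls⟩
  mul_mem := by
    rintro i j _ _ ⟨x, hx, rfl⟩ ⟨y, hy, rfl⟩
    exact ⟨x * y, SetLike.GradedMul.mul_mem (A := A.deg) hx hy, map_mul A.cls _ _⟩
  toDecomposition := A.cohomology_isInternal.chooseDecomposition

/-- The cohomology algebra `H(A)`, a graded algebra. -/
noncomputable def cohomology : GradedAlg k where
  carrier := A.CohomologyCarrier
  deg := A.cohomologyDeg

end DGAlg

/-! ### DG modules -/

/-- A left DG module over a DG algebra. -/
structure DGMod {k : Type u} [Field k] (A : DGAlg k) extends GradedMod A.toGradedAlg where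
  d : carrier →ₗ[k] carrier
  d_mem : ∀ {i : ℤ} {m : carrier}, m ∈ deg i → d m ∈ deg (i + 1)
  d_d : ∀ m, d (d m) = 0
  leibniz : ∀ {i : ℕ} {a : A.carrier} (m : carrier), a ∈ A.deg i →
    d (a • m) = A.d a • m + (-1 : k) ^ i • (a • d m)

namespace DGMod

variable {k : Type u} [Field k] {A : DGAlg k}

/-- A morphism of DG modules: a morphism of graded modules commuting with the differentials. -/
structure Hom (M N : DGMod A) extends GradedMod.Hom M.toGradedMod N.toGradedMod where
  comm : ∀ m, toLin (M.d m) = N.d (toLin m)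

/-- The (total) cohomology `H(M) = ker d / im d`. -/
abbrev Cohomology (M : DGMod A) : Type u :=
  LinearMap.ker M.d ⧸ (LinearMap.range M.d).submoduleOf (LinearMap.ker M.d)

/-- A morphism of DG modules, as a `k`-linear map on cocycles. -/
def Hom.onCocycles {M N : DGMod A} (f : Hom M N) : LinearMap.ker M.d →ₗ[k] LinearMap.ker N.d :=
  (f.toLin.restrictScalars k).restrict fun m hm => by
    have hm' : M.d m = 0 := hm
    have h := f.comm m
    rw [hm', map_zero] at h
    exact h.symm

/-- The map `H(f) : H(M) → H(N)` induced by a morphism of DG modules. -/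
def Hom.onCohomology {M N : DGMod A} (f : Hom M N) : M.Cohomology →ₗ[k] N.Cohomology :=
  Submodule.mapQ _ _ f.onCocycles (by
    rintro ⟨_, _⟩ ⟨m, rfl⟩
    exact ⟨f.toLin m, (f.comm m).symm⟩)

/-- A quasi-isomorphism of DG modules. -/
def Hom.IsQuasiIso {M N : DGMod A} (f : Hom M N) : Prop := Function.Bijective f.onCohomology

/-- A DG submodule: a graded `A`-submodule stable under the differential. -/
def IsDGSubmodule (M : DGMod A) (N : Submodule A.carrier M.carrier) : Prop :=
  (∀ (i : ℤ) (m : M.carrier), m ∈ N → (DirectSum.decompose M.deg m i : M.carrier) ∈ N) ∧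
  ∀ m ∈ N, M.d m ∈ N

/-- For DG submodules `N ≤ N'`, the DG module `N' / N` is DG free: it is a direct sum
`⨁_y A e_y` with `e_y` homogeneous and `∂ e_y = 0`, that is, it has a basis over the graded
algebra underlying `A` which consists of classes of homogeneous elements of `N'` whose
differential lies in `N`. -/
def IsDGFreeQuotient (M : DGMod A) (N N' : Submodule A.carrier M.carrier) : Prop :=
  ∃ (Y : Type u) (b : Module.Basis Y A.carrier (N' ⧸ N.submoduleOf N')),
    ∀ y, ∃ e : N', (N.submoduleOf N').mkQ e = b y ∧ (∃ i, (e : M.carrier) ∈ M.deg i) ∧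
      M.d e ∈ N

/-- A semi-free filtration `0 = F(-1) ⊆ F(0) ⊆ F(1) ⊆ ⋯` of `F`, by DG submodules with DG free
subquotients and union `F`. The index is shifted by one: `Φ n` is `F(n-1)`. -/
structure IsSemifreeFiltration (F : DGMod A) (Φ : ℕ → Submodule A.carrier F.carrier) : Prop where
  bot : Φ 0 = ⊥
  mono : Monotone Φ
  dgSubmodule : ∀ n, F.IsDGSubmodule (Φ n)
  exhaustive : ∀ x, ∃ n, x ∈ Φ n
  free : ∀ n, F.IsDGFreeQuotient (Φ n) (Φ (n + 1))

/-- A DG module is semi-free if it has a semi-free filtration. -/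
def IsSemifree (F : DGMod A) : Prop := ∃ Φ, F.IsSemifreeFiltration Φ

/-- The filtration is strictly increasing: `F(i-1) ≠ F(i)` as long as `F(i-1) ≠ F`. -/
def IsStrict (F : DGMod A) (Φ : ℕ → Submodule A.carrier F.carrier) : Prop :=
  ∀ i, Φ i ≠ ⊤ → Φ i ≠ Φ (i + 1)

/-- The filtration has length `n`: `F(n) = F` and `F(n-1) ≠ F`. The second condition is waived
for `n = 0`, where it only says that `F ≠ 0`; so the zero module has length `0`. -/
def HasLength (F : DGMod A) (Φ : ℕ → Submodule A.carrier F.carrier) (n : ℕ) : Prop :=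
  Φ (n + 1) = ⊤ ∧ (n ≠ 0 → Φ n ≠ ⊤)

/-- The DG free class of a semi-free DG module: the infimum of the lengths of its strictly
increasing semi-free filtrations. -/
noncomputable def dgFreeClass (F : DGMod A) : ℕ∞ :=
  ⨅ (n : ℕ) (_ : ∃ Φ, F.IsSemifreeFiltration Φ ∧ F.IsStrict Φ ∧ F.HasLength Φ n), (n : ℕ∞)

/-- The cone length of `M`: the infimum of the DG free classes of its semi-free resolutions. -/
noncomputable def coneLength (M : DGMod A) : ℕ∞ :=
  ⨅ (F : DGMod A) (_ : F.IsSemifree ∧ ∃ f : Hom F M, f.IsQuasiIso), F.dgFreeClass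

end DGMod

namespace DGAlg

variable {k : Type u} [Field k] (A : DGAlg k)

/-- The left global dimension of a DG algebra: the supremum of the cone lengths of its left DG
modules. -/
noncomputable def leftGlobalDim : ℕ∞ := ⨆ M : DGMod A, M.coneLength

/-- A DG algebra is connected if its underlying graded algebra is. -/
def IsConnected : Prop := A.toGradedAlg.IsConnected

variable {A}

/-- The augmentation `A → A^0 = k` of a connected DG algebra, with kernel `𝔪 = ⨁_{i > 0} A^i`. -/
noncomputable def augmentation (hA : A.IsConnected) : A.carrier →+* k :=
  (RingEquiv.ofBijective (algebraMap k (A.deg 0)) hA).symm.toRingHom.comp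
    (GradedRing.projZeroRingHom' A.deg)

lemma augmentation_eq_zero_iff (hA : A.IsConnected) (a : A.carrier) :
    augmentation hA a = 0 ↔ A.comp 0 a = 0 := by
  simp only [augmentation, RingHom.comp_apply]
  rw [RingEquiv.toRingHom_eq_coe, RingEquiv.coe_toRingHom, map_eq_zero_iff _ (RingEquiv.injective _),
    ← Subtype.coe_inj]
  rfl

lemma augmentation_algebraMap (hA : A.IsConnected) (r : k) :
    augmentation hA (algebraMap k A.carrier r) = r := by
  simp only [augmentation, RingHom.comp_apply]
  rw [RingEquiv.toRingHom_eq_coe, RingEquiv.coe_toRingHom, RingEquiv.symm_apply_eq]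
  exact GradedRing.projZeroRingHom'_apply_coe A.deg (algebraMap k (A.deg 0) r)

/-- The grading of `k` that is concentrated in degree `0`. -/
def residueDeg (k : Type u) [Field k] (i : ℤ) : Submodule k k := if i = 0 then ⊤ else ⊥

lemma residueDeg_isInternal (k : Type u) [Field k] : DirectSum.IsInternal (residueDeg k) := by
  classical
  constructor
  · rw [injective_iff_map_eq_zero]
    intro x hx
    have h0 : ∀ i, i ≠ 0 → x i = 0 := fun i hi => by
      have h : ∀ c ∈ residueDeg k i, c = 0 := fun c hc => by
        rw [residueDeg, if_neg hi] at hc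
        exact hc
      exact Subtype.ext (h _ (x i).2)
    have hx' : x = DirectSum.of (fun i => residueDeg k i) 0 (x 0) := by
      ext i
      by_cases hi : i = 0
      · subst hi; simp
      · rw [h0 i hi, DirectSum.of_eq_of_ne _ _ _ hi]
    rw [hx', DirectSum.coeAddMonoidHom_of] at hx
    have hx0 : x 0 = 0 := Subtype.ext hx
    rw [hx', hx0, map_zero]
  · intro c
    exact ⟨DirectSum.of (fun i => residueDeg k i) 0 ⟨c, by simp [residueDeg]⟩,
      DirectSum.coeAddMonoidHom_of _ _ _⟩

/-- The trivial DG module `k = A / 𝔪` over a connected DG algebra: it is concentrated in degree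
`0`, has zero differential, and `A` acts through the augmentation. -/
noncomputable def residue (hA : A.IsConnected) : DGMod A :=
  letI : Module A.carrier k := Module.compHom k (augmentation hA)
  have smul_def : ∀ (a : A.carrier) (c : k), a • c = augmentation hA a * c := fun _ _ => rfl
  haveI : IsScalarTower k A.carrier k := ⟨fun r a c => by
    rw [smul_def, smul_def, Algebra.smul_def, map_mul, augmentation_algebraMap, smul_eq_mul,
      mul_assoc]⟩
  { carrier := k
    deg := residueDeg k
    decomp := (residueDeg_isInternal k).chooseDecomposition
    smul_mem := by
      intro i j a c ha hc
      by_cases h : (i : ℤ) + j = 0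
      · simp [residueDeg, h]
      · suffices a • c = 0 by rw [this]; exact zero_mem _
        by_cases hj : j = 0
        · subst hj
          have h0 : augmentation hA a = 0 :=
            (augmentation_eq_zero_iff hA a).2 (A.comp_of_mem_ne ha (by omega))
          rw [smul_def, h0, zero_mul]
        · rw [residueDeg, if_neg hj] at hc
          have hc' : c = 0 := hc
          rw [hc', smul_zero]
    d := 0
    d_mem := fun _ => zero_mem _
    d_d := fun _ => rfl
    leibniz := by
      intro i a m _
      have h0 : augmentation hA (A.d a) = 0 :=
        (augmentation_eq_zero_iff hA _).2 (A.comp_zero_d a)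
      simp [smul_def, h0] }

end DGAlg

/-! Upper bound. For any `M`, the graded module `H(M)` has a free resolution `0 → G₂ → G₁ → G₀ →
H(M) → 0`; free rather than projective modules are available by Eilenberg's swindle
(`exists_prod_free_isGradedFree`). The cohomology of a DG free module is a free `H(A)`-module, so
the maps of the resolution lift to matrices of cocycles of `A`. Attaching the generators of `G₀`,
`G₁`, `G₂` one layer after the other gives a semi-free module with three layers and a
quasi-isomorphism to `M`. The only obstruction is a class in `H(M)` met at the last layer; it is
removed by changing the attaching cocycle, because `G₀ → H(M)` is surjective. Hence every cone
length is at most two (`exists_resolution_hasFiltration`).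

Lower bound. Suppose that `k` has a resolution `F` with two layers. The long exact sequence of `F(0)
⊆ F` has a connecting map `T` between free `H(A)`-modules and reduces to `0 → coker T → k → ker T →
0`. As `k` is one-dimensional, one outer term vanishes. Either `T` is injective with cokernel `k`,
or `T` is a split surjection with kernel `k`. In both cases Schanuel's lemma makes the augmentation
ideal of `H(A)` projective (`projective_augIdeal`).

A connected graded algebra `B` with projective augmentation ideal `I` has global dimension at most
one (`globalDim_le_one`). By a graded Nakayama argument `I` is free on homogeneous elements spanning
a copy `V` of `I/I²`, and then `0 → B ⊗ V ⊗ M → B ⊗ M → M → 0` is exact for every module `M`. This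
contradicts global dimension two. -/

/-! ### Gradings, and basic constructions with graded modules. -/

section Internal

variable {R ι M : Type*} [DecidableEq ι] [CommRing R] [AddCommGroup M] [Module R M]

/-- A family of submodules spanning `M` and separated by a family of projections is a grading. -/
lemma DirectSum.isInternal_of_proj (deg : ι → Submodule R M) (p : ι → M →ₗ[R] M)
    (same : ∀ i, ∀ x ∈ deg i, p i x = x) (ne : ∀ i j, ∀ x ∈ deg j, j ≠ i → p i x = 0)
    (span : ⨆ i, deg i = ⊤) : DirectSum.IsInternal deg := by
  refine (DirectSum.isInternal_submodule_iff_iSupIndep_and_iSup_eq_top deg).2 ⟨?_, span⟩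
  rw [iSupIndep_def]
  intro i
  rw [Submodule.disjoint_def]
  intro x hx hx'
  rw [← same i x hx]
  have : (⨆ j, ⨆ (_ : j ≠ i), deg j) ≤ LinearMap.ker (p i) :=
    iSup₂_le fun j hj y hy => ne i j y hy hj
  exact this hx'

end Internal

namespace GradedAlg

variable {k : Type u} [Field k] (B : GradedAlg k)

/-- The projection of a graded algebra onto its component of degree `i`. -/
noncomputable def comp (i : ℕ) : B.carrier →ₗ[k] B.carrier := GradedAlgebra.proj B.deg i

lemma comp_mem (i : ℕ) (a : B.carrier) : B.comp i a ∈ B.deg i := by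
  simp [comp, GradedAlgebra.proj_apply]

lemma comp_of_mem {i : ℕ} {a : B.carrier} (h : a ∈ B.deg i) : B.comp i a = a := by
  simp [comp, GradedAlgebra.proj_apply, DirectSum.decompose_of_mem_same _ h]

lemma comp_of_mem_ne {i j : ℕ} {a : B.carrier} (h : a ∈ B.deg i) (hij : i ≠ j) :
    B.comp j a = 0 := by
  simp [comp, GradedAlgebra.proj_apply, DirectSum.decompose_of_mem_ne _ h hij]

lemma exists_sum_comp (a : B.carrier) : ∃ s : Finset ℕ, ∑ i ∈ s, B.comp i a = a := by
  classical
  exact ⟨_, DirectSum.sum_support_decompose B.deg a⟩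

lemma exists_comp_eq_zero (a : B.carrier) : ∃ N : ℕ, ∀ i, N ≤ i → B.comp i a = 0 := by
  classical
  obtain ⟨s, hs⟩ := B.exists_sum_comp a
  refine ⟨s.sup id + 1, fun i hi => ?_⟩
  rw [← hs, map_sum]
  refine Finset.sum_eq_zero fun j hj => B.comp_of_mem_ne (B.comp_mem j a) ?_
  have : j ≤ s.sup id := Finset.le_sup (f := id) hj
  omega

lemma ext_comp {a b : B.carrier} (h : ∀ i, B.comp i a = B.comp i b) : a = b := by
  apply (DirectSum.decompose B.deg).injective
  ext i
  exact h i

lemma one_mem : (1 : B.carrier) ∈ B.deg 0 := SetLike.GradedOne.one_mem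

lemma mul_mem {i j : ℕ} {a b : B.carrier} (ha : a ∈ B.deg i) (hb : b ∈ B.deg j) :
    a * b ∈ B.deg (i + j) := SetLike.GradedMul.mul_mem ha hb

lemma algebraMap_mem (r : k) : algebraMap k B.carrier r ∈ B.deg 0 :=
  SetLike.algebraMap_mem_graded B.deg r

/-- The grading of a graded algebra, extended to `ℤ` by zero. -/
def degZ (n : ℤ) : Submodule k B.carrier := if 0 ≤ n then B.deg n.toNat else ⊥

lemma degZ_natCast (n : ℕ) : B.degZ n = B.deg n := by simp [degZ]

lemma mem_degZ {n : ℤ} {a : B.carrier} (h : a ∈ B.degZ n) :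
    a = 0 ∨ ∃ i : ℕ, n = i ∧ a ∈ B.deg i := by
  unfold degZ at h
  split_ifs at h with hn
  · exact Or.inr ⟨n.toNat, by omega, h⟩
  · exact Or.inl h

lemma mem_degZ_of_mem {n : ℤ} {i : ℕ} {a : B.carrier} (h : a ∈ B.deg i) (hn : n = i) :
    a ∈ B.degZ n := by
  subst hn
  rwa [degZ_natCast]

lemma mul_mem_degZ {i : ℕ} {n l : ℤ} {a b : B.carrier} (ha : a ∈ B.deg i) (hb : b ∈ B.degZ n)
    (hl : l = i + n) : a * b ∈ B.degZ l := by
  obtain rfl | ⟨j, rfl, hj⟩ := B.mem_degZ hb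
  · simp
  · exact B.mem_degZ_of_mem (B.mul_mem ha hj) (by simp [hl])

/-- The projection onto the component of degree `n`, for `n` an integer. -/
noncomputable def compZ (n : ℤ) : B.carrier →ₗ[k] B.carrier := if 0 ≤ n then B.comp n.toNat else 0

lemma compZ_of_mem {n : ℤ} {a : B.carrier} (h : a ∈ B.degZ n) : B.compZ n a = a := by
  obtain rfl | ⟨j, rfl, hj⟩ := B.mem_degZ h
  · simp
  · simpa [compZ] using B.comp_of_mem hj

lemma compZ_of_mem_ne {n l : ℤ} {a : B.carrier} (h : a ∈ B.degZ n) (hn : n ≠ l) :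
    B.compZ l a = 0 := by
  obtain rfl | ⟨j, rfl, hj⟩ := B.mem_degZ h
  · simp
  · unfold compZ
    split_ifs with hl
    · exact B.comp_of_mem_ne hj (by omega)
    · rfl

end GradedAlg

namespace GradedMod

variable {k : Type u} [Field k] {B : GradedAlg k}

section Comp

variable (M : GradedMod B)

/-- The projection of a graded module onto its component of degree `i`. -/
noncomputable def comp (i : ℤ) : M.carrier →ₗ[k] M.carrier where
  toFun m := (DirectSum.decompose M.deg m i : M.carrier)
  map_add' := by simp
  map_smul' r m := by
    rw [DirectSum.decompose_smul]
    rfl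

lemma comp_mem (i : ℤ) (m : M.carrier) : M.comp i m ∈ M.deg i :=
  (DirectSum.decompose M.deg m i).2

lemma comp_of_mem {i : ℤ} {m : M.carrier} (h : m ∈ M.deg i) : M.comp i m = m :=
  DirectSum.decompose_of_mem_same _ h

lemma comp_of_mem_ne {i j : ℤ} {m : M.carrier} (h : m ∈ M.deg i) (hij : i ≠ j) :
    M.comp j m = 0 :=
  DirectSum.decompose_of_mem_ne _ h hij

lemma exists_sum_comp (m : M.carrier) : ∃ s : Finset ℤ, ∑ i ∈ s, M.comp i m = m := by
  classical
  exact ⟨_, DirectSum.sum_support_decompose M.deg m⟩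

lemma comp_smul {i : ℕ} {a : B.carrier} (ha : a ∈ B.deg i) {j l : ℤ} (hl : l = i + j)
    (m : M.carrier) : M.comp l (a • m) = a • M.comp j m := by
  subst hl
  induction m using DirectSum.Decomposition.inductionOn M.deg with
  | zero => simp
  | @homogeneous l m =>
    by_cases h : l = j
    · subst h
      rw [M.comp_of_mem m.2, M.comp_of_mem (M.smul_mem ha m.2)]
    · rw [M.comp_of_mem_ne m.2 h, M.comp_of_mem_ne (M.smul_mem ha m.2) (by omega), smul_zero]
  | add x y hx hy => simp [hx, hy]

lemma iSup_deg : ⨆ i, M.deg i = ⊤ :=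
  (DirectSum.Decomposition.isInternal M.deg).submodule_iSup_eq_top

variable {M}

lemma Hom.comp_map {N : GradedMod B} (f : Hom M N) (i : ℤ) (m : M.carrier) :
    N.comp i (f.toLin m) = f.toLin (M.comp i m) := by
  induction m using DirectSum.Decomposition.inductionOn M.deg with
  | zero => simp
  | @homogeneous j m =>
    by_cases h : j = i
    · subst h
      rw [M.comp_of_mem m.2, N.comp_of_mem (f.map_deg _ _ m.2)]
    · rw [M.comp_of_mem_ne m.2 h, N.comp_of_mem_ne (f.map_deg _ _ m.2) h, map_zero]
  | add x y hx hy => simp [hx, hy]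

end Comp

/-- Composition of morphisms of graded modules. -/
def Hom.trans {M N P : GradedMod B} (f : Hom M N) (g : Hom N P) : Hom M P where
  toLin := g.toLin ∘ₗ f.toLin
  map_deg i m hm := g.map_deg i _ (f.map_deg i m hm)

lemma prod_deg_isInternal (M N : GradedMod B) :
    DirectSum.IsInternal fun i => (M.deg i).prod (N.deg i) := by
  refine DirectSum.isInternal_of_proj _ (fun i => (M.comp i).prodMap (N.comp i))
    (fun i x hx => by ext <;> simp [M.comp_of_mem hx.1, N.comp_of_mem hx.2])
    (fun i j x hx h => by ext <;> simp [M.comp_of_mem_ne hx.1 h, N.comp_of_mem_ne hx.2 h]) ?_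
  rw [eq_top_iff]
  intro x _
  have h1 : (⨆ i, M.deg i) ≤
      (⨆ i, (M.deg i).prod (N.deg i)).comap (LinearMap.inl k M.carrier N.carrier) :=
    iSup_le fun i y hy => Submodule.mem_iSup_of_mem i ⟨hy, zero_mem _⟩
  have h2 : (⨆ i, N.deg i) ≤
      (⨆ i, (M.deg i).prod (N.deg i)).comap (LinearMap.inr k M.carrier N.carrier) :=
    iSup_le fun i y hy => Submodule.mem_iSup_of_mem i ⟨zero_mem _, hy⟩
  rw [M.iSup_deg] at h1
  rw [N.iSup_deg] at h2
  have h3 := h1 (Submodule.mem_top (x := x.1))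
  have h4 := h2 (Submodule.mem_top (x := x.2))
  have := add_mem (Submodule.mem_comap.1 h3) (Submodule.mem_comap.1 h4)
  simpa using this

/-- The direct sum of two graded modules. -/
noncomputable abbrev prod (M N : GradedMod B) : GradedMod B where
  carrier := M.carrier × N.carrier
  deg i := (M.deg i).prod (N.deg i)
  decomp := (prod_deg_isInternal M N).chooseDecomposition
  smul_mem ha hm := ⟨M.smul_mem ha hm.1, N.smul_mem ha hm.2⟩

/-- The elements of degree `i` of the graded free module with basis elements of degree `δ y`. -/
def freeDeg (B : GradedAlg k) {Y : Type u} (δ : Y → ℤ) (i : ℤ) : Submodule k (Y →₀ B.carrier) where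
  carrier := {f | ∀ y, f y ∈ B.degZ (i - δ y)}
  add_mem' hf hg y := add_mem (hf y) (hg y)
  zero_mem' _ := zero_mem _
  smul_mem' r _ hf y := Submodule.smul_mem _ r (hf y)

lemma single_mem_freeDeg {Y : Type u} {δ : Y → ℤ} {i : ℤ} {y : Y} {a : B.carrier}
    (h : a ∈ B.degZ (i - δ y)) : Finsupp.single y a ∈ freeDeg B δ i := by
  classical
  intro z
  rw [Finsupp.single_apply]
  split_ifs with hz
  · exact hz ▸ h
  · exact zero_mem _

lemma single_one_mem_freeDeg {Y : Type u} {δ : Y → ℤ} (y : Y) :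
    Finsupp.single y (1 : B.carrier) ∈ freeDeg B δ (δ y) :=
  single_mem_freeDeg (B.mem_degZ_of_mem B.one_mem (by simp))

lemma freeDeg_isInternal (B : GradedAlg k) {Y : Type u} (δ : Y → ℤ) :
    DirectSum.IsInternal (freeDeg B δ) := by
  refine DirectSum.isInternal_of_proj _
    (fun i => Finsupp.lsum k fun y => Finsupp.lsingle y ∘ₗ B.compZ (i - δ y))
    (fun i f hf => ?_) (fun i j f hf h => ?_) ?_
  · rw [Finsupp.lsum_apply]
    conv_rhs => rw [← Finsupp.sum_single f]
    exact Finsupp.sum_congr fun y _ => by simp [B.compZ_of_mem (hf y)]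
  · rw [Finsupp.lsum_apply]
    exact Finset.sum_eq_zero fun y _ => by
      simp [B.compZ_of_mem_ne (l := i - δ y) (hf y) (by omega)]
  · rw [eq_top_iff]
    intro f _
    induction f using Finsupp.induction_linear with
    | zero => exact zero_mem _
    | add f g hf hg => exact add_mem (hf trivial) (hg trivial)
    | single y a =>
      obtain ⟨s, hs⟩ := B.exists_sum_comp a
      rw [← hs, Finsupp.single_finsetSum]
      exact Submodule.sum_mem _ fun j _ => Submodule.mem_iSup_of_mem ((j : ℤ) + δ y)
        (single_mem_freeDeg (B.mem_degZ_of_mem (B.comp_mem j a) (by ring)))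

/-- The graded free module with basis `Y`, the basis element `y` being of degree `δ y`. -/
noncomputable abbrev free (B : GradedAlg k) {Y : Type u} (δ : Y → ℤ) : GradedMod B where
  carrier := Y →₀ B.carrier
  deg := freeDeg B δ
  decomp := (freeDeg_isInternal B δ).chooseDecomposition
  smul_mem ha hm y := B.mul_mem_degZ ha (hm y) (by ring)

lemma ker_deg_isInternal {M N : GradedMod B} (f : Hom M N) : DirectSum.IsInternal fun i =>
    (M.deg i).comap ((LinearMap.ker f.toLin).subtype.restrictScalars k) := by
  have h : ∀ i, ∀ x : LinearMap.ker f.toLin, f.toLin (M.comp i x) = 0 := fun i x => by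
    rw [← f.comp_map, x.2, map_zero]
  refine DirectSum.isInternal_of_proj _
    (fun i =>
      { toFun := fun x => ⟨M.comp i x, h i x⟩
        map_add' := fun x y => by ext; simp
        map_smul' := fun r x => by
          ext
          exact (M.comp i).map_smul r x })
    (fun i x hx => Subtype.ext (M.comp_of_mem hx))
    (fun i j x hx h => Subtype.ext (M.comp_of_mem_ne hx h)) ?_
  rw [eq_top_iff]
  intro x _
  obtain ⟨s, hs⟩ := M.exists_sum_comp x
  have : x = ∑ i ∈ s, (⟨M.comp i x, h i x⟩ : LinearMap.ker f.toLin) := by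
    ext
    rw [AddSubmonoidClass.coe_finsetSum]
    exact hs.symm
  rw [this]
  exact Submodule.sum_mem _ fun i _ => Submodule.mem_iSup_of_mem i (M.comp_mem i x)

/-- The kernel of a morphism of graded modules. -/
noncomputable abbrev ker {M N : GradedMod B} (f : Hom M N) : GradedMod B where
  carrier := LinearMap.ker f.toLin
  deg i := (M.deg i).comap ((LinearMap.ker f.toLin).subtype.restrictScalars k)
  decomp := (ker_deg_isInternal f).chooseDecomposition
  smul_mem ha hm := M.smul_mem ha hm

lemma zero_deg_isInternal (k : Type u) [Field k] :
    DirectSum.IsInternal fun _ : ℤ => (⊥ : Submodule k PUnit.{u + 1}) :=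
  DirectSum.isInternal_of_proj _ (fun _ => 0) (fun _ _ _ => rfl) (fun _ _ _ _ _ => rfl)
    (Subsingleton.elim _ _)

/-- The zero graded module. -/
noncomputable abbrev zero (B : GradedAlg k) : GradedMod B where
  carrier := PUnit.{u + 1}
  deg _ := ⊥
  decomp := (zero_deg_isInternal k).chooseDecomposition
  smul_mem _ _ := Subsingleton.elim _ _

/-- The shift `l` is `0` for morphisms out of a free module and `1` for the differential of attached
generators. -/
lemma linearCombination_mem {Y : Type u} {δ : Y → ℤ} {N : GradedMod B} {n : Y → N.carrier}
    {l : ℤ} (hn : ∀ y, n y ∈ N.deg (δ y + l)) {i j : ℤ} {f : Y →₀ B.carrier}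
    (hf : f ∈ freeDeg B δ i) (hj : j = i + l) :
    Finsupp.linearCombination B.carrier n f ∈ N.deg j := by
  rw [Finsupp.linearCombination_apply]
  refine Submodule.sum_mem _ fun y _ => ?_
  obtain h | ⟨t, ht, h⟩ := B.mem_degZ (hf y)
  · simp [h]
  · have := N.smul_mem h (hn y)
    rwa [show (t : ℤ) + (δ y + l) = j by omega] at this

/-- A morphism out of a graded free module, given by the images of the basis elements. -/
noncomputable def free.lift {Y : Type u} {δ : Y → ℤ} {N : GradedMod B} (n : Y → N.carrier)
    (hn : ∀ y, n y ∈ N.deg (δ y)) : Hom (free B δ) N where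
  toLin := Finsupp.linearCombination B.carrier n
  map_deg i f hf := linearCombination_mem (l := 0) (δ := δ) (by simpa using hn) hf (by simp)

/-- A graded module that has a basis of homogeneous elements. -/
def IsGradedFree (M : GradedMod B) : Prop :=
  ∃ (Y : Type u) (b : Module.Basis Y B.carrier M.carrier), ∀ y, ∃ i, b y ∈ M.deg i

end GradedMod

/-! ### Graded projective modules and graded free resolutions. -/

namespace GradedMod

variable {k : Type u} [Field k] {B : GradedAlg k}

lemma exists_free_cover (N : GradedMod B) : ∃ (Y : Type u) (δ : Y → ℤ) (f : Hom (free B δ) N),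
    Function.Surjective f.toLin := by
  -- One basis element for each homogeneous element of `N`.
  refine ⟨Σ i : ℤ, N.deg i, Sigma.fst, free.lift (fun y => y.2) fun y => y.2.2, ?_⟩
  rw [← LinearMap.range_eq_top, eq_top_iff]
  intro x _
  obtain ⟨s, hs⟩ := N.exists_sum_comp x
  rw [← hs]
  refine Submodule.sum_mem _ fun i _ => ⟨Finsupp.single ⟨i, N.comp i x, N.comp_mem i x⟩ 1, ?_⟩
  simp [free.lift]

/-- The identity morphism. -/
def Hom.id (N : GradedMod B) : Hom N N where
  toLin := LinearMap.id
  map_deg _ _ h := h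

lemma IsProjective.exists_section {P M : GradedMod B} (hP : P.IsProjective) (g : Hom M P)
    (hg : Function.Surjective g.toLin) : ∃ s : Hom P M, ∀ x, g.toLin (s.toLin x) = x :=
  hP M P g (Hom.id P) hg

lemma IsProjective.module_projective {P : GradedMod B} (hP : P.IsProjective) :
    Module.Projective B.carrier P.carrier := by
  obtain ⟨Y, δ, f, hf⟩ := P.exists_free_cover
  obtain ⟨s, hs⟩ := hP.exists_section f hf
  exact Module.Projective.of_split s.toLin f.toLin (LinearMap.ext hs)

/-- The degree-preserving part of a linear map between graded modules, as a `k`-linear map. -/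
noncomputable def degreePart {P N : GradedMod B} (h : P.carrier →ₗ[B.carrier] N.carrier) :
    P.carrier →ₗ[k] N.carrier :=
  (DirectSum.toModule k ℤ N.carrier fun i =>
    N.comp i ∘ₗ h.restrictScalars k ∘ₗ (P.deg i).subtype) ∘ₗ
      (DirectSum.decomposeLinearEquiv P.deg).toLinearMap

lemma degreePart_of_mem {P N : GradedMod B} (h : P.carrier →ₗ[B.carrier] N.carrier) {i : ℤ}
    {x : P.carrier} (hx : x ∈ P.deg i) : degreePart h x = N.comp i (h x) := by
  lift x to P.deg i using hx
  simp only [degreePart, LinearMap.comp_apply, LinearEquiv.coe_coe,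
    DirectSum.decomposeLinearEquiv_apply_coe, DirectSum.toModule_lof]
  rfl

lemma degreePart_smul {P N : GradedMod B} (h : P.carrier →ₗ[B.carrier] N.carrier) (a : B.carrier)
    (x : P.carrier) : degreePart h (a • x) = a • degreePart h x := by
  induction x using DirectSum.Decomposition.inductionOn P.deg with
  | zero => simp
  | add x y hx hy => simp [hx, hy]
  | @homogeneous i x =>
    induction a using DirectSum.Decomposition.inductionOn B.deg with
    | zero => simp
    | add a b ha hb => simp [ha, hb, add_smul]
    | @homogeneous j a =>
      rw [degreePart_of_mem h (P.smul_mem a.2 x.2), degreePart_of_mem h x.2, map_smul,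
        N.comp_smul a.2 rfl]

/-- An ungraded lift exists; its degree-preserving part is still a lift, since `f` and `g` preserve
degrees. -/
lemma isProjective_of_module_projective {P : GradedMod B}
    (hP : Module.Projective B.carrier P.carrier) : P.IsProjective := by
  intro M N g f hg
  obtain ⟨h, hh⟩ := Module.projective_lifting_property g.toLin f.toLin hg
  refine ⟨⟨{ toFun := degreePart h, map_add' := map_add _, map_smul' := degreePart_smul h },
    fun i x hx => ?_⟩, fun x => ?_⟩
  · change degreePart h x ∈ _
    rw [degreePart_of_mem h hx]
    exact M.comp_mem _ _
  · change g.toLin (degreePart h x) = _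
    induction x using DirectSum.Decomposition.inductionOn P.deg with
    | zero => simp
    | add x y hx hy => simp [hx, hy]
    | @homogeneous i x =>
      rw [degreePart_of_mem h x.2, ← g.comp_map, ← LinearMap.comp_apply, hh,
        N.comp_of_mem (f.map_deg _ _ x.2)]

lemma isProjective_iff {P : GradedMod B} :
    P.IsProjective ↔ Module.Projective B.carrier P.carrier :=
  ⟨IsProjective.module_projective, isProjective_of_module_projective⟩

lemma isGradedFree_free {Y : Type u} (δ : Y → ℤ) : (free B δ).IsGradedFree :=
  ⟨Y, Finsupp.basisSingleOne, fun y => ⟨δ y, by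
    rw [Finsupp.coe_basisSingleOne]; exact single_one_mem_freeDeg y⟩⟩

lemma IsGradedFree.prod {M N : GradedMod B} (hM : M.IsGradedFree) (hN : N.IsGradedFree) :
    (M.prod N).IsGradedFree := by
  obtain ⟨Y, b, hb⟩ := hM
  obtain ⟨Y', b', hb'⟩ := hN
  refine ⟨Y ⊕ Y', b.prod b', ?_⟩
  rintro (y | y)
  · obtain ⟨i, hi⟩ := hb y
    exact ⟨i, by simpa using hi, by simp⟩
  · obtain ⟨i, hi⟩ := hb' y
    exact ⟨i, by simp, by simpa using hi⟩

/-- Eilenberg's swindle for graded modules. -/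
lemma exists_prod_free_isGradedFree (P : GradedMod B) [Module.Projective B.carrier P.carrier] :
    ∃ (Y : Type u) (δ : Y → ℤ), (P.prod (free B δ)).IsGradedFree := by
  obtain ⟨Y, δ, f, hf⟩ := P.exists_free_cover
  obtain ⟨s, hs⟩ := (isProjective_iff.2 ‹_›).exists_section f hf
  -- With `P` embedded by `s`, the free module is `P ⊕ Q`: `e` projects onto `P` and `c` onto the
  -- complement `Q`.
  let e : (Y →₀ B.carrier) →ₗ[B.carrier] (Y →₀ B.carrier) := s.toLin ∘ₗ f.toLin
  let c : (Y →₀ B.carrier) →ₗ[B.carrier] (Y →₀ B.carrier) := LinearMap.id - e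
  let ι (n : ℕ) : (Y →₀ B.carrier) →ₗ[B.carrier] (ℕ × Y →₀ B.carrier) :=
    Finsupp.lmapDomain B.carrier B.carrier (Prod.mk n)
  have hι : ∀ n y a, ι n (Finsupp.single y a) = Finsupp.single (n, y) a := fun n y a => by simp [ι]
  have hfe : ∀ x, f.toLin (e x) = f.toLin x := fun x => hs _
  have hfc : ∀ x, f.toLin (c x) = 0 := fun x => by simp [c, hfe]
  have hee : ∀ x, e (e x) = e x := fun x => by simp [e, hs]
  have hec : ∀ x, e (c x) = 0 := fun x => by simp [c, hee]
  have hce : ∀ x, c (e x) = 0 := fun x => by simp [c, hee]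
  have hcc : ∀ x, c (c x) = c x := fun x => by simp [c, hee]
  have hes : ∀ p, e (s.toLin p) = s.toLin p := fun p => by simp [e, hs]
  have hcs : ∀ p, c (s.toLin p) = 0 := fun p => by simp [c, hes]
  have hadd : ∀ x, e x + c x = x := fun x => by simp [c]
  -- The swindle `(P ⊕ Q) ⊕ (P ⊕ Q) ⊕ ⋯ ≅ P ⊕ (P ⊕ Q) ⊕ (P ⊕ Q) ⊕ ⋯`. The summand `Q` of copy `n`
  -- stays in place; the summand `P` of copy `n + 1` moves to copy `n`, and that of copy `0` becomes
  -- the extra `P`. The inverse `Θ` moves every `P` back.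
  let u : ℕ → (Y →₀ B.carrier) →ₗ[B.carrier] (P.carrier × (ℕ × Y →₀ B.carrier)) := fun n =>
    match n with
    | 0 => f.toLin.prod (ι 0 ∘ₗ c)
    | n + 1 => LinearMap.inr _ _ _ ∘ₗ (ι n ∘ₗ e + ι (n + 1) ∘ₗ c)
  let Ψ : (ℕ × Y →₀ B.carrier) →ₗ[B.carrier] (P.carrier × (ℕ × Y →₀ B.carrier)) :=
    Finsupp.linearCombination B.carrier fun q => u q.1 (Finsupp.single q.2 1)
  let θ : (ℕ × Y →₀ B.carrier) →ₗ[B.carrier] (ℕ × Y →₀ B.carrier) :=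
    Finsupp.linearCombination B.carrier fun q =>
      (ι (q.1 + 1) ∘ₗ e + ι q.1 ∘ₗ c) (Finsupp.single q.2 1)
  let Θ : (P.carrier × (ℕ × Y →₀ B.carrier)) →ₗ[B.carrier] (ℕ × Y →₀ B.carrier) :=
    (ι 0 ∘ₗ s.toLin).coprod θ
  have hΨ : ∀ n, Ψ ∘ₗ ι n = u n := fun n => by
    refine Finsupp.lhom_ext' fun y => LinearMap.ext_ring ?_
    simp [Ψ, hι]
  have hΨ' : ∀ n x, Ψ (ι n x) = u n x := fun n x => by rw [← hΨ]; rfl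
  have hθ : ∀ n, θ ∘ₗ ι n = ι (n + 1) ∘ₗ e + ι n ∘ₗ c := fun n => by
    refine Finsupp.lhom_ext' fun y => LinearMap.ext_ring ?_
    simp [θ, hι]
  have hθ' : ∀ n x, θ (ι n x) = ι (n + 1) (e x) + ι n (c x) := fun n x => by
    rw [← LinearMap.comp_apply, hθ]; rfl
  have hu0 : ∀ x, u 0 x = (f.toLin x, ι 0 (c x)) := fun x => rfl
  have hu1 : ∀ n x, u (n + 1) x = (0, ι n (e x) + ι (n + 1) (c x)) := fun n x => rfl
  have h1 : Θ ∘ₗ Ψ = LinearMap.id := by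
    refine Finsupp.lhom_ext' fun q => LinearMap.ext_ring ?_
    obtain ⟨n, y⟩ := q
    simp only [LinearMap.comp_apply, Finsupp.lsingle_apply, LinearMap.id_apply]
    rw [← hι, hΨ']
    cases n with
    | zero =>
      rw [hu0]
      simp only [Θ, LinearMap.coprod_apply, hθ', LinearMap.comp_apply, hec, hcc]
      rw [map_zero, zero_add, ← map_add]
      exact congrArg (ι 0) (hadd _)
    | succ n =>
      rw [hu1]
      simp only [Θ, LinearMap.coprod_apply, hθ', hec, hcc, map_add, hee, hce,
        map_zero, add_zero, zero_add]
      rw [← map_add, hadd]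
  have h2 : Ψ ∘ₗ Θ = LinearMap.id := by
    refine LinearMap.prod_ext (LinearMap.ext fun p => ?_)
      (Finsupp.lhom_ext' fun q => LinearMap.ext_ring ?_)
    · simp [Θ, hΨ', hu0, hcs, hs]
    · obtain ⟨n, y⟩ := q
      simp only [LinearMap.comp_apply, Finsupp.lsingle_apply, LinearMap.id_apply, Θ,
        LinearMap.inr_apply]
      rw [← hι]
      simp only [LinearMap.coprod_apply, map_zero, zero_add, hθ', map_add, hΨ', hu1, hee, hce]
      cases n with
      | zero => simp [hu0, hfc, hcc, ← map_add, hadd]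
      | succ n => simp [hu1, hec, hcc, ← map_add, hadd]
  refine ⟨ℕ × Y, fun q => δ q.2, ℕ × Y,
    ⟨(LinearEquiv.ofLinearMap Ψ Θ h2 h1).symm⟩, fun q => ⟨δ q.2, ?_⟩⟩
  have hmem : ∀ n, ∀ x ∈ freeDeg B δ (δ q.2), ι n x ∈ freeDeg B (fun q : ℕ × Y => δ q.2) (δ q.2) :=
    fun n x hx => by
      rintro ⟨n', y⟩
      classical
      change (Finsupp.mapDomain (Prod.mk n) x) (n', y) ∈ _
      by_cases h : n' = n
      · subst h
        rw [Finsupp.mapDomain_apply (Prod.mk_right_injective n')]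
        exact hx y
      · rw [Finsupp.mapDomain_of_notMem_range]
        · exact zero_mem _
        · rintro ⟨z, hz⟩
          exact h (congrArg Prod.fst hz).symm
  have he : ∀ x ∈ freeDeg B δ (δ q.2), e x ∈ freeDeg B δ (δ q.2) :=
    fun x hx => s.map_deg _ _ (f.map_deg _ _ hx)
  have hc : ∀ x ∈ freeDeg B δ (δ q.2), c x ∈ freeDeg B δ (δ q.2) :=
    fun x hx => sub_mem hx (he x hx)
  have hb : (Module.Basis.ofRepr (LinearEquiv.ofLinearMap Ψ Θ h2 h1).symm) q
      = u q.1 (Finsupp.single q.2 1) := by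
    change Ψ (Finsupp.single q 1) = _
    simp [Ψ]
  rw [hb]
  have h1 := single_one_mem_freeDeg (B := B) (δ := δ) q.2
  obtain ⟨n, y⟩ := q
  cases n with
  | zero => exact ⟨f.map_deg _ _ h1, hmem _ _ (hc _ h1)⟩
  | succ n => exact ⟨zero_mem _, add_mem (hmem _ _ (he _ h1)) (hmem _ _ (hc _ h1))⟩

/-- A graded module of projective dimension at most two has a graded free resolution of length
two. -/
lemma exists_free_resolution {N : GradedMod B} (hN : N.projDim ≤ 2) :
    ∃ (G₀ G₁ G₂ : GradedMod B) (ε : Hom G₀ N) (β : Hom G₁ G₀) (α : Hom G₂ G₁),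
      G₀.IsGradedFree ∧ G₁.IsGradedFree ∧ G₂.IsGradedFree ∧ Function.Surjective ε.toLin ∧
      Function.Exact β.toLin ε.toLin ∧ Function.Exact α.toLin β.toLin ∧
      Function.Injective α.toLin := by
  obtain ⟨n, hn, P, D, ε, hP, hsub, hε, h0, hex⟩ : ∃ n, n ≤ 2 ∧ N.HasProjResolution n := by
    have h3 : N.projDim < 3 := lt_of_le_of_lt hN (by norm_num)
    simp only [projDim, iInf_lt_iff] at h3
    obtain ⟨n, h, hn⟩ := h3
    have : n < 3 := by exact_mod_cast hn
    exact ⟨n, by omega, h⟩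
  -- `P 3` vanishes, so exactness at `P 2` is injectivity.
  have hinj : Function.Injective (D 1).toLin := by
    have := hsub 3 (by omega)
    rw [injective_iff_map_eq_zero]
    intro x hx
    obtain ⟨y, rfl⟩ := (hex 1 x).1 hx
    rw [Subsingleton.elim y 0, map_zero]
  have hpr : ∀ i, Module.Projective B.carrier (P i).carrier := fun i => isProjective_iff.1 (hP i)
  -- A free module added to `P i` to make it free is also added to `P (i + 1)`, with the identity
  -- between the two copies, which keeps the sequence exact. The last one, added to `P 2`, goes to
  -- `P 1` as well: that term is already free and stays so.
  obtain ⟨Y₀, δ₀, hG₀⟩ := (P 0).exists_prod_free_isGradedFree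
  have := hpr 1
  obtain ⟨Y₁, δ₁, hG₁⟩ := ((P 1).prod (free B δ₀)).exists_prod_free_isGradedFree
  have := hpr 2
  obtain ⟨Y₂, δ₂, hG₂⟩ := ((P 2).prod (free B δ₁)).exists_prod_free_isGradedFree
  refine ⟨(P 0).prod (free B δ₀), (((P 1).prod (free B δ₀)).prod (free B δ₁)).prod (free B δ₂),
    ((P 2).prod (free B δ₁)).prod (free B δ₂),
    ⟨ε.toLin ∘ₗ LinearMap.fst _ _ _, fun i x hx => ε.map_deg i _ hx.1⟩,
    ⟨((D 0).toLin.prodMap LinearMap.id) ∘ₗ LinearMap.fst _ _ _ ∘ₗ LinearMap.fst _ _ _,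
      fun i x hx => ⟨(D 0).map_deg i _ hx.1.1.1, hx.1.1.2⟩⟩,
    ⟨((LinearMap.inl _ _ _ ∘ₗ (D 1).toLin).prodMap LinearMap.id).prodMap LinearMap.id,
      fun i x hx => ⟨⟨⟨(D 1).map_deg i _ hx.1.1, zero_mem _⟩, hx.1.2⟩, hx.2⟩⟩,
    hG₀, hG₁.prod (isGradedFree_free δ₂), hG₂, ?_, ?_, ?_, ?_⟩
  · intro x
    obtain ⟨y, rfl⟩ := hε x
    exact ⟨(y, 0), rfl⟩
  · rintro ⟨p, x⟩
    constructor
    · intro h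
      obtain ⟨q, rfl⟩ := (h0 p).1 h
      exact ⟨(((q, x), 0), 0), rfl⟩
    · rintro ⟨⟨⟨⟨q, x'⟩, _⟩, _⟩, h⟩
      obtain ⟨rfl, -⟩ := Prod.ext_iff.1 h
      exact (h0 _).2 ⟨q, rfl⟩
  · rintro ⟨⟨⟨p, x⟩, x₁⟩, x₂⟩
    constructor
    · intro h
      obtain ⟨h, h'⟩ := Prod.ext_iff.1 h
      obtain ⟨q, rfl⟩ := (hex 0 p).1 h
      obtain rfl : x = 0 := h'
      exact ⟨((q, x₁), x₂), rfl⟩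
    · rintro ⟨⟨⟨q, _⟩, _⟩, h⟩
      obtain ⟨⟨⟨rfl, rfl⟩, -⟩, -⟩ := by simpa [Prod.ext_iff] using h
      exact Prod.ext ((hex 0 _).2 ⟨q, rfl⟩) rfl
  · exact Function.Injective.prodMap (Function.Injective.prodMap
      (LinearMap.inl_injective.comp hinj) fun _ _ h => h) fun _ _ h => h

end GradedMod

/-! ### Signs, and DG modules obtained by attaching free generators. -/

namespace DGAlg

variable {k : Type u} [Field k] (A : DGAlg k)

/-- The sign involution `a ↦ (-1)^|a| a`. -/
noncomputable def sgn : A.carrier →ₗ[k] A.carrier :=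
  (DirectSum.toModule k ℕ A.carrier fun i => (-1 : k) ^ i • (A.deg i).subtype) ∘ₗ
    (DirectSum.decomposeLinearEquiv A.deg).toLinearMap

lemma sgn_of_mem {i : ℕ} {a : A.carrier} (ha : a ∈ A.deg i) : A.sgn a = (-1 : k) ^ i • a := by
  lift a to A.deg i using ha
  simp only [sgn, LinearMap.comp_apply, LinearEquiv.coe_coe,
    DirectSum.decomposeLinearEquiv_apply_coe, DirectSum.toModule_lof]
  rfl

lemma sgn_mul (a b : A.carrier) : A.sgn (a * b) = A.sgn a * A.sgn b := by
  induction a using DirectSum.Decomposition.inductionOn A.deg with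
  | zero => simp
  | add x y hx hy => simp [hx, hy, add_mul]
  | @homogeneous i a =>
    induction b using DirectSum.Decomposition.inductionOn A.deg with
    | zero => simp
    | add x y hx hy => simp [hx, hy, mul_add]
    | @homogeneous j b =>
      rw [A.sgn_of_mem (A.mul_mem a.2 b.2), A.sgn_of_mem a.2, A.sgn_of_mem b.2, smul_mul_smul_comm,
        pow_add]

@[simp] lemma sgn_sgn (a : A.carrier) : A.sgn (A.sgn a) = a := by
  induction a using DirectSum.Decomposition.inductionOn A.deg with
  | zero => simp
  | add x y hx hy => simp [hx, hy]
  | homogeneous a =>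
    rw [A.sgn_of_mem a.2, map_smul, A.sgn_of_mem a.2, smul_smul, ← mul_pow]
    simp

@[simp] lemma d_sgn (a : A.carrier) : A.d (A.sgn a) = -A.sgn (A.d a) := by
  induction a using DirectSum.Decomposition.inductionOn A.deg with
  | zero => simp
  | add x y hx hy => simp [hx, hy, add_comm]
  | homogeneous a =>
    rw [A.sgn_of_mem a.2, map_smul, A.sgn_of_mem (A.d_mem a.2), pow_succ]
    simp

lemma sgn_mem {n : ℤ} {a : A.carrier} (ha : a ∈ A.degZ n) : A.sgn a ∈ A.degZ n := by
  obtain rfl | ⟨i, rfl, h⟩ := A.mem_degZ ha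
  · simp
  · rw [A.sgn_of_mem h]
    exact Submodule.smul_mem _ _ ha

lemma d_mem_degZ {n l : ℤ} {a : A.carrier} (ha : a ∈ A.degZ n) (hl : l = n + 1) :
    A.d a ∈ A.degZ l := by
  obtain rfl | ⟨i, rfl, h⟩ := A.mem_degZ ha
  · simp
  · exact A.mem_degZ_of_mem (A.d_mem h) (by simp [hl])

/-- With the sign involution the Leibniz rule is linear in `a`, so homogeneity need not be assumed
from here on. -/
lemma d_mul (a b : A.carrier) : A.d (a * b) = A.d a * b + A.sgn a * A.d b := by
  induction a using DirectSum.Decomposition.inductionOn A.deg with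
  | zero => simp
  | add x y hx hy => simp [hx, hy, add_mul]; abel
  | homogeneous a => rw [A.leibniz b a.2, A.sgn_of_mem a.2, smul_mul_assoc]

/-- The sign involution on a graded free module. -/
noncomputable def finsuppSgn (Y : Type u) : (Y →₀ A.carrier) →ₗ[k] (Y →₀ A.carrier) :=
  Finsupp.mapRange.linearMap A.sgn

/-- The differential of the DG free module with basis `Y`. -/
noncomputable def finsuppD (Y : Type u) : (Y →₀ A.carrier) →ₗ[k] (Y →₀ A.carrier) :=
  Finsupp.mapRange.linearMap A.d

variable {Y : Type u}

@[simp] lemma finsuppSgn_apply (f : Y →₀ A.carrier) (y : Y) :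
    A.finsuppSgn Y f y = A.sgn (f y) := by simp [finsuppSgn]

@[simp] lemma finsuppD_apply (f : Y →₀ A.carrier) (y : Y) :
    A.finsuppD Y f y = A.d (f y) := by simp [finsuppD]

@[simp] lemma finsuppSgn_single (y : Y) (a : A.carrier) :
    A.finsuppSgn Y (Finsupp.single y a) = Finsupp.single y (A.sgn a) := by simp [finsuppSgn]

@[simp] lemma finsuppD_single (y : Y) (a : A.carrier) :
    A.finsuppD Y (Finsupp.single y a) = Finsupp.single y (A.d a) := by simp [finsuppD]

@[simp] lemma finsuppSgn_finsuppSgn (f : Y →₀ A.carrier) :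
    A.finsuppSgn Y (A.finsuppSgn Y f) = f := by ext; simp

@[simp] lemma finsuppD_finsuppD (f : Y →₀ A.carrier) :
    A.finsuppD Y (A.finsuppD Y f) = 0 := by ext; simp [A.d_d]

@[simp] lemma finsuppD_finsuppSgn (f : Y →₀ A.carrier) :
    A.finsuppD Y (A.finsuppSgn Y f) = -A.finsuppSgn Y (A.finsuppD Y f) := by ext; simp

lemma finsuppSgn_smul (a : A.carrier) (f : Y →₀ A.carrier) :
    A.finsuppSgn Y (a • f) = A.sgn a • A.finsuppSgn Y f := by ext; simp [A.sgn_mul]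

lemma finsuppD_smul (a : A.carrier) (f : Y →₀ A.carrier) :
    A.finsuppD Y (a • f) = A.d a • f + A.sgn a • A.finsuppD Y f := by ext; simp [A.d_mul]

lemma finsuppSgn_mem {δ : Y → ℤ} {i : ℤ} {f : Y →₀ A.carrier}
    (hf : f ∈ GradedMod.freeDeg A.toGradedAlg δ i) :
    A.finsuppSgn Y f ∈ GradedMod.freeDeg A.toGradedAlg δ i := fun y => by
  rw [finsuppSgn_apply]
  exact A.sgn_mem (hf y)

lemma finsuppD_mem {δ : Y → ℤ} {i : ℤ} {f : Y →₀ A.carrier}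
    (hf : f ∈ GradedMod.freeDeg A.toGradedAlg δ i) :
    A.finsuppD Y f ∈ GradedMod.freeDeg A.toGradedAlg δ (i + 1) := fun y => by
  rw [finsuppD_apply]
  exact A.d_mem_degZ (hf y) (by ring)

end DGAlg

namespace DGMod

variable {k : Type u} [Field k] {A : DGAlg k}

lemma d_smul (M : DGMod A) (a : A.carrier) (m : M.carrier) :
    M.d (a • m) = A.d a • m + A.sgn a • M.d m := by
  induction a using DirectSum.Decomposition.inductionOn A.deg with
  | zero => simp
  | add x y hx hy => simp [hx, hy, add_smul]; abel
  | homogeneous a => rw [M.leibniz m a.2, A.sgn_of_mem a.2, smul_assoc]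

lemma d_linearCombination (M : DGMod A) {Y : Type u} (z : Y → M.carrier) (f : Y →₀ A.carrier) :
    M.d (Finsupp.linearCombination A.carrier z f) =
      Finsupp.linearCombination A.carrier z (A.finsuppD Y f) +
        Finsupp.linearCombination A.carrier (fun y => M.d (z y)) (A.finsuppSgn Y f) := by
  induction f using Finsupp.induction_linear with
  | zero => simp
  | add f g hf hg => simp only [map_add, hf, hg]; abel
  | single y a => simp [M.d_smul]

lemma linearCombination_smul_k (M : DGMod A) {Y : Type u} (z : Y → M.carrier) (r : k)
    (f : Y →₀ A.carrier) : Finsupp.linearCombination A.carrier z (r • f) =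
      r • Finsupp.linearCombination A.carrier z f :=
  ((Finsupp.linearCombination A.carrier z).restrictScalars k).map_smul r f

lemma comp_d (M : DGMod A) {i j : ℤ} (hj : j = i + 1) (m : M.carrier) :
    M.comp j (M.d m) = M.d (M.comp i m) := by
  subst hj
  induction m using DirectSum.Decomposition.inductionOn M.deg with
  | zero => simp
  | @homogeneous j m =>
    by_cases h : j = i
    · subst h
      rw [M.comp_of_mem m.2, M.comp_of_mem (M.d_mem m.2)]
    · rw [M.comp_of_mem_ne m.2 h, M.comp_of_mem_ne (M.d_mem m.2) (by omega), map_zero]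
  | add x y hx hy => simp [hx, hy]

/-- The DG module obtained from `M` by attaching free generators `e_y` of degree `δ y` with
differential `z y`. -/
noncomputable abbrev attach (M : DGMod A) {Y : Type u} (δ : Y → ℤ) (z : Y → M.carrier)
    (hz : ∀ y, z y ∈ M.deg (δ y + 1)) (hdz : ∀ y, M.d (z y) = 0) : DGMod A where
  toGradedMod := M.toGradedMod.prod (GradedMod.free A.toGradedAlg δ)
  -- The sign involution comes from `d (a e_y) = d a • e_y + (-1)^|a| a • z y`.
  d := (M.d ∘ₗ LinearMap.fst k _ _ +
      (Finsupp.linearCombination A.carrier z).restrictScalars k ∘ₗ A.finsuppSgn Y ∘ₗ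
        LinearMap.snd k _ _).prod (A.finsuppD Y ∘ₗ LinearMap.snd k _ _)
  d_mem {i} m hm := ⟨add_mem (M.d_mem hm.1)
    (GradedMod.linearCombination_mem hz (A.finsuppSgn_mem hm.2) rfl), A.finsuppD_mem hm.2⟩
  d_d m := by
    ext : 1
    · simp [M.d_linearCombination, show (fun y => M.d (z y)) = 0 from funext hdz, M.d_d]
    · simp
  leibniz {i a} m ha := by
    ext : 1
    · simp [M.d_smul, A.finsuppSgn_smul, A.sgn_of_mem ha, add_assoc]
    · simp [A.finsuppD_smul, A.sgn_of_mem ha]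

section Attach

variable (M : DGMod A) {Y : Type u} (δ : Y → ℤ) (z : Y → M.carrier)
  (hz : ∀ y, z y ∈ M.deg (δ y + 1)) (hdz : ∀ y, M.d (z y) = 0)

lemma attach_d (m : M.carrier) (f : Y →₀ A.carrier) : (M.attach δ z hz hdz).d (m, f) =
    (M.d m + Finsupp.linearCombination A.carrier z (A.finsuppSgn Y f), A.finsuppD Y f) := rfl

/-- The extension to `M.attach δ z` of a morphism out of `M`. -/
noncomputable def attachLift {N : DGMod A} (f : Hom M N) (w : Y → N.carrier)
    (hw : ∀ y, w y ∈ N.deg (δ y)) (hdw : ∀ y, N.d (w y) = f.toLin (z y)) :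
    Hom (M.attach δ z hz hdz) N where
  toLin := f.toLin.coprod (Finsupp.linearCombination A.carrier w)
  map_deg i m hm := add_mem (f.map_deg i _ hm.1)
    (GradedMod.linearCombination_mem (l := 0) (δ := δ) (by simpa using hw) hm.2 (by simp))
  comm := by
    rintro ⟨m, g⟩
    rw [attach_d]
    simp only [LinearMap.coprod_apply, map_add, f.comm, N.d_linearCombination, hdw]
    rw [Finsupp.apply_linearCombination]
    simp only [Function.comp_def]
    abel

end Attach

/-- The zero DG module. -/
noncomputable abbrev zero (A : DGAlg k) : DGMod A where
  toGradedMod := GradedMod.zero A.toGradedAlg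
  d := 0
  d_mem _ := zero_mem _
  d_d _ := rfl
  leibniz _ _ := Subsingleton.elim _ _

/-- The morphism out of the zero DG module. -/
noncomputable def fromZero (M : DGMod A) : Hom (zero A) M where
  toLin := 0
  map_deg _ _ _ := zero_mem _
  comm m := by simp

end DGMod

/-! ### The cohomology of a DG module as a graded module over `H(A)`. -/

namespace DGMod

variable {k : Type u} [Field k] {A : DGAlg k}

/-- The class of a cocycle. -/
def cls (M : DGMod A) : LinearMap.ker M.d →ₗ[k] M.Cohomology := Submodule.mkQ _

section Cohomology

variable (M : DGMod A)

lemma cls_surjective : Function.Surjective M.cls := Submodule.mkQ_surjective _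

lemma cls_eq_zero_iff {m : LinearMap.ker M.d} : M.cls m = 0 ↔ ∃ x, M.d x = m :=
  Submodule.Quotient.mk_eq_zero _

/-- The action of a cocycle of `A` on the cocycles of a DG module. -/
def cocycleAct (z : A.cocycles) : LinearMap.ker M.d →ₗ[k] LinearMap.ker M.d where
  toFun m := ⟨(z : A.carrier) • (m : M.carrier), by
    have h1 : A.d z = 0 := z.2
    have h2 : M.d m = 0 := m.2
    rw [LinearMap.mem_ker, M.d_smul, h1, h2]
    simp⟩
  map_add' x y := by ext; simp
  map_smul' r x := by ext; exact smul_comm (z : A.carrier) r (x : M.carrier)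

/-- The action of the cocycles of `A` on the cohomology of a DG module. -/
def cocyclesToEnd : A.cocycles →ₐ[k] Module.End k M.Cohomology :=
  AlgHom.ofLinearMap
    { toFun := fun z => Submodule.mapQ _ _ (M.cocycleAct z) (by
        rintro ⟨_, hm⟩ ⟨m, rfl⟩
        -- For a cocycle `z` the sign is absorbed: `z • d m = d (sgn z • m)`.
        refine ⟨A.sgn z • m, ?_⟩
        have h1 : A.d z = 0 := z.2
        simp [M.d_smul, h1, cocycleAct])
      map_add' := fun x y => by
        ext m
        exact congrArg M.cls (Subtype.ext (add_smul (x : A.carrier) y (m : M.carrier)))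
      map_smul' := fun r x => by
        ext m
        exact congrArg M.cls (Subtype.ext (smul_assoc r (x : A.carrier) (m : M.carrier))) }
    (by
      ext m
      exact congrArg M.cls (Subtype.ext (one_smul A.carrier (m : M.carrier))))
    (fun x y => by
      ext m
      exact congrArg M.cls (Subtype.ext (mul_smul (x : A.carrier) y (m : M.carrier))))

lemma cocyclesToEnd_eq_zero {z : A.cocycles} (hz : z ∈ A.coboundaries) :
    M.cocyclesToEnd z = 0 := by
  obtain ⟨a, ha⟩ := hz
  ext m
  refine (M.cls_eq_zero_iff).2 ⟨a • (m : M.carrier), ?_⟩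
  have h2 : M.d m = 0 := m.2
  rw [M.d_smul, h2, ha]
  simp [cocycleAct]

/-- The action of `H(A)` on `H(M)`. -/
def cohomologyToEnd : A.CohomologyCarrier →ₐ[k] Module.End k M.Cohomology :=
  Ideal.Quotient.liftₐ A.coboundaries M.cocyclesToEnd fun _ h => M.cocyclesToEnd_eq_zero h

/-- `H^i(M)`: the classes of the cocycles of degree `i`. -/
def cohomologyDeg (i : ℤ) : Submodule k M.Cohomology :=
  ((M.deg i).comap (LinearMap.ker M.d).subtype).map M.cls

lemma d_comp_eq_zero (i : ℤ) {m : M.carrier} (hm : M.d m = 0) : M.d (M.comp i m) = 0 := by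
  rw [← M.comp_d rfl, hm, map_zero]

/-- The projection of a cohomology class onto its component of degree `i`. -/
noncomputable def cohomologyComp (i : ℤ) : M.Cohomology →ₗ[k] M.Cohomology :=
  Submodule.mapQ _ _ ((M.comp i).restrict fun _ hm => M.d_comp_eq_zero i hm) (by
    rintro ⟨_, hm⟩ ⟨m, rfl⟩
    exact ⟨M.comp (i - 1) m, (M.comp_d (by ring) m).symm⟩)

lemma cohomologyComp_cls (i : ℤ) (m : LinearMap.ker M.d) :
    M.cohomologyComp i (M.cls m) = M.cls ⟨M.comp i m, M.d_comp_eq_zero i m.2⟩ := rfl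

lemma cohomologyDeg_isInternal : DirectSum.IsInternal M.cohomologyDeg := by
  refine DirectSum.isInternal_of_proj _ M.cohomologyComp ?_ ?_ ?_
  · rintro i _ ⟨m, hm, rfl⟩
    rw [cohomologyComp_cls]
    exact congrArg M.cls (Subtype.ext (M.comp_of_mem hm))
  · rintro i j _ ⟨m, hm, rfl⟩ hij
    rw [cohomologyComp_cls, ← map_zero M.cls]
    exact congrArg M.cls (Subtype.ext (M.comp_of_mem_ne hm hij))
  · rw [eq_top_iff]
    intro x _
    obtain ⟨m, rfl⟩ := M.cls_surjective x
    obtain ⟨s, hs⟩ := M.exists_sum_comp m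
    have : m = ∑ i ∈ s, (⟨M.comp i m, M.d_comp_eq_zero i m.2⟩ : LinearMap.ker M.d) := by
      ext
      rw [AddSubmonoidClass.coe_finsetSum]
      exact hs.symm
    rw [this, map_sum]
    exact Submodule.sum_mem _ fun i _ => Submodule.mem_iSup_of_mem i ⟨_, M.comp_mem i m, rfl⟩

/-- The action of `H(A)` on `H(M)`, for `H(A)` as a graded algebra. -/
def cohomologyAction : A.cohomology.carrier →ₐ[k] Module.End k M.Cohomology := M.cohomologyToEnd

/-- The cohomology of a DG module, as a graded module over the cohomology algebra. -/
noncomputable def cohomology : GradedMod A.cohomology :=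
  letI : Module A.cohomology.carrier M.Cohomology :=
    Module.compHom M.Cohomology M.cohomologyAction.toRingHom
  { carrier := M.Cohomology
    module := this
    tower := ⟨fun r a x => by
      change M.cohomologyAction (r • a) x = r • M.cohomologyAction a x
      rw [map_smul]
      rfl⟩
    deg := M.cohomologyDeg
    decomp := M.cohomologyDeg_isInternal.chooseDecomposition
    smul_mem := by
      rintro i j _ _ ⟨z, hz, rfl⟩ ⟨m, hm, rfl⟩
      exact ⟨M.cocycleAct z m, M.smul_mem hz hm, rfl⟩ }

end Cohomology

end DGMod

namespace DGAlg

variable {k : Type u} [Field k] (A : DGAlg k)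

/-- The class of a cocycle, as an element of the graded algebra `H(A)`. -/
noncomputable def hcls : A.cocycles →ₐ[k] A.cohomology.carrier := A.cls

lemma hcls_surjective : Function.Surjective A.hcls := A.cls_surjective

lemma hcls_eq_zero_iff {z : A.cocycles} : A.hcls z = 0 ↔ ∃ a, A.d a = z := A.cls_eq_zero_iff

lemma mem_cohomology_degZ {i : ℤ} {x : A.cohomology.carrier} (hx : x ∈ A.cohomology.degZ i) :
    ∃ z : A.cocycles, (z : A.carrier) ∈ A.degZ i ∧ A.hcls z = x := by
  obtain rfl | ⟨j, rfl, z, hz, rfl⟩ := A.cohomology.mem_degZ hx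
  · exact ⟨0, by simp, map_zero _⟩
  · exact ⟨z, A.mem_degZ_of_mem hz rfl, rfl⟩

end DGAlg

namespace DGMod

variable {k : Type u} [Field k] {A : DGAlg k} (M : DGMod A)

/-- The class of a cocycle, as an element of the graded module `H(M)`. -/
noncomputable def hcls : LinearMap.ker M.d →ₗ[k] M.cohomology.carrier := M.cls

lemma hcls_surjective : Function.Surjective M.hcls := M.cls_surjective

lemma hcls_eq_zero_iff {m : LinearMap.ker M.d} : M.hcls m = 0 ↔ ∃ x, M.d x = m :=
  M.cls_eq_zero_iff

lemma mem_cohomology_deg {i : ℤ} {x : M.cohomology.carrier} : x ∈ M.cohomology.deg i ↔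
    ∃ m : LinearMap.ker M.d, (m : M.carrier) ∈ M.deg i ∧ M.hcls m = x := Iff.rfl

lemma hcls_smul_hcls (z : A.cocycles) (m : LinearMap.ker M.d) :
    A.hcls z • M.hcls m = M.hcls (M.cocycleAct z m) := rfl

end DGMod

/-! ### Standard free resolutions, and the cohomology of DG free modules. -/

namespace GradedMod

variable {k : Type u} [Field k] {B : GradedAlg k}

lemma Hom.exists_mem_deg {M N : GradedMod B} (f : Hom M N) {i : ℤ} {n : N.carrier}
    (hn : n ∈ N.deg i) (h : ∃ m, f.toLin m = n) : ∃ m ∈ M.deg i, f.toLin m = n := by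
  obtain ⟨m, rfl⟩ := h
  exact ⟨M.comp i m, M.comp_mem i m, by rw [← f.comp_map, N.comp_of_mem hn]⟩

lemma IsGradedFree.exists_iso {G : GradedMod B} (hG : G.IsGradedFree) :
    ∃ (Y : Type u) (δ : Y → ℤ) (f : Hom (free B δ) G) (g : Hom G (free B δ)),
      (∀ x, g.toLin (f.toLin x) = x) ∧ ∀ x, f.toLin (g.toLin x) = x := by
  obtain ⟨Y, b, hb⟩ := hG
  choose δ hδ using hb
  let f : Hom (free B δ) G := free.lift b hδ
  have hf : f.toLin = b.repr.symm.toLinearMap := by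
    refine Finsupp.lhom_ext' fun y => LinearMap.ext_ring ?_
    simp [f, free.lift]
  have hf' : ∀ x, f.toLin x = b.repr.symm x := fun x => by rw [hf]; rfl
  refine ⟨Y, δ, f, ⟨b.repr.toLinearMap, fun i x hx => ?_⟩, fun x => ?_, fun x => ?_⟩
  · obtain ⟨y, hy, rfl⟩ := f.exists_mem_deg hx ⟨b.repr x, by simp [hf']⟩
    simpa [hf'] using hy
  · simp [hf']
  · simp [hf']

/-- A graded module of projective dimension at most two has a resolution of length two by the
standard graded free modules. -/
lemma exists_standard_free_resolution {N : GradedMod B} (hN : N.projDim ≤ 2) :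
    ∃ (Y₀ Y₁ Y₂ : Type u) (δ₀ : Y₀ → ℤ) (δ₁ : Y₁ → ℤ) (δ₂ : Y₂ → ℤ)
      (ε : Hom (free B δ₀) N) (β : Hom (free B δ₁) (free B δ₀)) (α : Hom (free B δ₂) (free B δ₁)),
      Function.Surjective ε.toLin ∧ Function.Exact β.toLin ε.toLin ∧
      Function.Exact α.toLin β.toLin ∧ Function.Injective α.toLin := by
  obtain ⟨G₀, G₁, G₂, ε, β, α, h₀, h₁, h₂, hε, hβ, hα, hinj⟩ := exists_free_resolution hN
  obtain ⟨Y₀, δ₀, f₀, g₀, hgf₀, hfg₀⟩ := h₀.exists_iso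
  obtain ⟨Y₁, δ₁, f₁, g₁, hgf₁, hfg₁⟩ := h₁.exists_iso
  obtain ⟨Y₂, δ₂, f₂, g₂, hgf₂, hfg₂⟩ := h₂.exists_iso
  refine ⟨Y₀, Y₁, Y₂, δ₀, δ₁, δ₂, f₀.trans ε, (f₁.trans β).trans g₀, (f₂.trans α).trans g₁,
    fun x => ?_, fun x => ⟨fun h => ?_, ?_⟩, fun x => ⟨fun h => ?_, ?_⟩, fun x y h => ?_⟩
  · obtain ⟨y, rfl⟩ := hε x
    exact ⟨g₀.toLin y, by simp [Hom.trans, hfg₀]⟩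
  · obtain ⟨y, hy⟩ := (hβ _).1 h
    exact ⟨g₁.toLin y, by simp [Hom.trans, hfg₁, hy, hgf₀]⟩
  · rintro ⟨y, rfl⟩
    simpa [Hom.trans, hfg₀] using (hβ _).2 ⟨_, rfl⟩
  · have h' : g₀.toLin (β.toLin (f₁.toLin x)) = 0 := h
    have h'' : β.toLin (f₁.toLin x) = 0 := by rw [← hfg₀ (β.toLin _), h', map_zero]
    obtain ⟨y, hy⟩ := (hα _).1 h''
    exact ⟨g₂.toLin y, by simp [Hom.trans, hfg₂, hy, hgf₁]⟩
  · rintro ⟨y, rfl⟩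
    have := (hα (α.toLin (f₂.toLin y))).2 ⟨_, rfl⟩
    simp [Hom.trans, hfg₁, this]
  · have h' : g₁.toLin (α.toLin (f₂.toLin x)) = g₁.toLin (α.toLin (f₂.toLin y)) := h
    rw [← hgf₂ x, ← hgf₂ y]
    congr 1
    apply hinj
    rw [← hfg₁ (α.toLin _), h', hfg₁]

end GradedMod

namespace DGAlg

variable {k : Type u} [Field k] (A : DGAlg k) {Y : Type u}

lemma d_apply_eq_zero (f : LinearMap.ker (A.finsuppD Y)) (y : Y) :
    (f : Y →₀ A.carrier) y ∈ A.cocycles := by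
  have h : A.finsuppD Y f = 0 := f.2
  rw [mem_cocycles, ← finsuppD_apply, h]
  rfl

/-- The class of a cocycle of the DG free module with basis `Y`. -/
noncomputable def finsuppCls (Y : Type u) :
    LinearMap.ker (A.finsuppD Y) →ₗ[k] (Y →₀ A.cohomology.carrier) where
  toFun f := Finsupp.onFinset f.1.support (fun y => A.hcls ⟨f.1 y, A.d_apply_eq_zero f y⟩)
    (fun y h => by
      rw [Finsupp.mem_support_iff]
      intro h0
      apply h
      rw [← map_zero A.hcls]
      exact congrArg A.hcls (Subtype.ext h0))
  map_add' f g := by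
    ext y
    exact map_add A.hcls ⟨f.1 y, A.d_apply_eq_zero f y⟩ ⟨g.1 y, A.d_apply_eq_zero g y⟩
  map_smul' r f := by
    ext y
    exact map_smul A.hcls r ⟨f.1 y, A.d_apply_eq_zero f y⟩

lemma finsuppCls_apply (f : LinearMap.ker (A.finsuppD Y)) (y : Y) :
    A.finsuppCls Y f y = A.hcls ⟨f.1 y, A.d_apply_eq_zero f y⟩ := rfl

lemma support_finsuppCls_subset (f : LinearMap.ker (A.finsuppD Y)) :
    (A.finsuppCls Y f).support ⊆ f.1.support :=
  fun y hy => by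
    contrapose! hy
    rw [Finsupp.notMem_support_iff] at hy ⊢
    rw [finsuppCls_apply, ← map_zero A.hcls]
    exact congrArg A.hcls (Subtype.ext hy)

/-- Homogeneous classes lift to homogeneous cocycles. -/
lemma exists_finsuppCls_eq_of_mem {δ : Y → ℤ} {i : ℤ} {x : Y →₀ A.cohomology.carrier}
    (hx : x ∈ GradedMod.freeDeg A.cohomology δ i) :
    ∃ f : LinearMap.ker (A.finsuppD Y), f.1 ∈ GradedMod.freeDeg A.toGradedAlg δ i ∧
      A.finsuppCls Y f = x := by
  -- The zero class is represented by zero, so that the chosen representatives have finite support.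
  have h : ∀ y, ∃ z : A.cocycles, (z : A.carrier) ∈ A.degZ (i - δ y) ∧ A.hcls z = x y ∧
      (x y = 0 → z = 0) := fun y => by
    by_cases h0 : x y = 0
    · exact ⟨0, by simp, by simp [h0], fun _ => rfl⟩
    · obtain ⟨z, hz, hzx⟩ := A.mem_cohomology_degZ (hx y)
      exact ⟨z, hz, hzx, fun h => absurd h h0⟩
  choose z hz hzx hz0 using h
  refine ⟨⟨Finsupp.onFinset x.support (fun y => z y) fun y hy => ?_, ?_⟩, hz, ?_⟩
  · rw [Finsupp.mem_support_iff]
    exact fun h0 => hy (by rw [hz0 y h0]; rfl)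
  · rw [LinearMap.mem_ker]
    ext y
    rw [finsuppD_apply]
    exact (z y).2
  · ext y
    exact hzx y

lemma exists_finsuppCls_eq (x : Y →₀ A.cohomology.carrier) :
    ∃ f : LinearMap.ker (A.finsuppD Y), A.finsuppCls Y f = x := by
  -- Any degrees for the basis elements would do; they only serve to split `x` into homogeneous
  -- parts.
  obtain ⟨s, hs⟩ := (GradedMod.free A.cohomology fun _ : Y => 0).exists_sum_comp x
  choose f _ hf using fun i => A.exists_finsuppCls_eq_of_mem
    ((GradedMod.free A.cohomology fun _ : Y => 0).comp_mem i x)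
  exact ⟨∑ i ∈ s, f i, by rw [map_sum, ← hs]; exact Finset.sum_congr rfl fun i _ => hf i⟩

/-- With `exists_finsuppCls_eq` this identifies the cohomology of the DG free module on `Y` with the
free `H(A)`-module on `Y`. -/
lemma finsuppCls_eq_zero_iff {f : LinearMap.ker (A.finsuppD Y)} :
    A.finsuppCls Y f = 0 ↔ ∃ g, A.finsuppD Y g = f := by
  constructor
  · intro h
    have h1 : ∀ y, ∃ a, A.d a = f.1 y ∧ (f.1 y = 0 → a = 0) := fun y => by
      by_cases h0 : f.1 y = 0
      · exact ⟨0, by simp [h0], fun _ => rfl⟩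
      · obtain ⟨a, ha⟩ := A.hcls_eq_zero_iff.1 (DFunLike.congr_fun h y)
        exact ⟨a, ha, fun h => absurd h h0⟩
    choose a ha ha0 using h1
    refine ⟨Finsupp.onFinset f.1.support a fun y hy => ?_, ?_⟩
    · rw [Finsupp.mem_support_iff]
      exact fun h0 => hy (ha0 y h0)
    · ext y
      rw [finsuppD_apply]
      exact ha y
  · rintro ⟨g, hg⟩
    ext y
    rw [finsuppCls_apply]
    exact A.hcls_eq_zero_iff.2 ⟨g y, by simp [← hg]⟩

lemma finsuppCls_single_one {x : LinearMap.ker (A.finsuppD Y)} {y : Y}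
    (hx : x.1 = Finsupp.single y 1) : A.finsuppCls Y x = Finsupp.single y 1 := by
  classical
  ext j
  rw [Finsupp.single_apply, finsuppCls_apply]
  split_ifs with hj
  · subst hj
    refine Eq.trans (congrArg A.hcls (Subtype.ext ?_)) (map_one A.hcls)
    simp [hx]
  · refine Eq.trans (congrArg A.hcls (Subtype.ext ?_)) (map_zero A.hcls)
    simp [hx, hj]

lemma finsuppD_linearCombination {Y' : Type u} (z : Y → LinearMap.ker (A.finsuppD Y'))
    (f : Y →₀ A.carrier) :
    A.finsuppD Y' (Finsupp.linearCombination A.carrier (fun y => (z y).1) f) =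
      Finsupp.linearCombination A.carrier (fun y => (z y).1) (A.finsuppD Y f) := by
  induction f using Finsupp.induction_linear with
  | zero => simp
  | add f g hf hg => simp only [map_add, hf, hg]
  | single y a =>
    have h : A.finsuppD Y' (z y).1 = 0 := (z y).2
    simp [A.finsuppD_smul, h]

/-- A matrix of cocycles acts on cohomology through the matrix of their classes. This turns maps
between free `H(A)`-modules into maps of DG free modules and back. -/
lemma finsuppCls_linearCombination {Y' : Type u} (z : Y → LinearMap.ker (A.finsuppD Y'))
    (f : LinearMap.ker (A.finsuppD Y)) {x : LinearMap.ker (A.finsuppD Y')}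
    (hx : x.1 = Finsupp.linearCombination A.carrier (fun y => (z y).1) f.1) :
    A.finsuppCls Y' x =
      Finsupp.linearCombination A.cohomology.carrier (fun y => A.finsuppCls Y' (z y))
        (A.finsuppCls Y f) := by
  ext j
  rw [Finsupp.linearCombination_apply,
    Finsupp.sum_of_support_subset _ (A.support_finsuppCls_subset f) _ (by simp), Finsupp.coe_finsetSum,
    Finset.sum_apply]
  simp only [Finsupp.smul_apply, finsuppCls_apply, smul_eq_mul, ← map_mul, ← map_sum]
  refine congrArg A.hcls (Subtype.ext ?_)
  rw [AddSubmonoidClass.coe_finsetSum]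
  simp [hx, Finsupp.linearCombination_apply, Finsupp.sum, Finsupp.coe_finsetSum]

end DGAlg

namespace DGMod

variable {k : Type u} [Field k] {A : DGAlg k} (M : DGMod A) {Y : Type u}

lemma d_linearCombination_cocycle (m : Y → LinearMap.ker M.d) (f : Y →₀ A.carrier) :
    M.d (Finsupp.linearCombination A.carrier (fun y => (m y).1) f) =
      Finsupp.linearCombination A.carrier (fun y => (m y).1) (A.finsuppD Y f) := by
  rw [M.d_linearCombination, show (fun y => M.d (m y).1) = 0 from funext fun y => (m y).2]
  simp

lemma hcls_linearCombination (m : Y → LinearMap.ker M.d) (f : LinearMap.ker (A.finsuppD Y))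
    {x : LinearMap.ker M.d}
    (hx : x.1 = Finsupp.linearCombination A.carrier (fun y => (m y).1) f.1) :
    M.hcls x =
      Finsupp.linearCombination A.cohomology.carrier (fun y => M.hcls (m y))
        (A.finsuppCls Y f) := by
  rw [Finsupp.linearCombination_apply,
    Finsupp.sum_of_support_subset _ (A.support_finsuppCls_subset f) _ (by simp)]
  simp only [DGAlg.finsuppCls_apply, hcls_smul_hcls, ← map_sum]
  refine congrArg M.hcls (Subtype.ext ?_)
  rw [AddSubmonoidClass.coe_finsetSum, hx]
  rfl

lemma exists_mem_deg_d_eq {i : ℤ} {m : M.carrier} (hm : m ∈ M.deg (i + 1)) (h : ∃ x, M.d x = m) :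
    ∃ x ∈ M.deg i, M.d x = m := by
  obtain ⟨x, rfl⟩ := h
  exact ⟨M.comp i x, M.comp_mem i x, by rw [← M.comp_d rfl, M.comp_of_mem hm]⟩

variable {M}

/-- Reduces the later arguments to cocycles and the elements that bound them, without quotients. -/
lemma Hom.isQuasiIso_iff {N : DGMod A} (f : Hom M N) : f.IsQuasiIso ↔
    (∀ x, M.d x = 0 → (∃ n, N.d n = f.toLin x) → ∃ y, M.d y = x) ∧
    ∀ n, N.d n = 0 → ∃ x, M.d x = 0 ∧ ∃ n', N.d n' = f.toLin x - n := by
  have hf : ∀ m, f.onCohomology (M.cls m) = N.cls (f.onCocycles m) := fun m => rfl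
  rw [IsQuasiIso, Function.Bijective, injective_iff_map_eq_zero]
  refine and_congr ⟨fun h x hx hn => ?_, fun h c hc => ?_⟩ ⟨fun h n hn => ?_, fun h c => ?_⟩
  · refine (M.cls_eq_zero_iff (m := ⟨x, hx⟩)).1 (h _ ?_)
    rw [hf]
    exact N.cls_eq_zero_iff.2 hn
  · obtain ⟨⟨x, hx⟩, rfl⟩ := M.cls_surjective c
    rw [hf] at hc
    exact M.cls_eq_zero_iff.2 (h x hx (N.cls_eq_zero_iff.1 hc))
  · obtain ⟨c, hc⟩ := h (N.cls ⟨n, hn⟩)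
    obtain ⟨⟨x, hx⟩, rfl⟩ := M.cls_surjective c
    refine ⟨x, hx, ?_⟩
    rw [hf, ← sub_eq_zero, ← map_sub] at hc
    exact N.cls_eq_zero_iff.1 hc
  · obtain ⟨⟨n, hn⟩, rfl⟩ := N.cls_surjective c
    obtain ⟨x, hx, h'⟩ := h n hn
    refine ⟨M.cls ⟨x, hx⟩, ?_⟩
    rw [hf, ← sub_eq_zero, ← map_sub]
    exact N.cls_eq_zero_iff.2 h'

end DGMod

/-! ### Semi-free filtrations of bounded length. -/

namespace DGMod

variable {k : Type u} [Field k] {A : DGAlg k}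

/-- A basis of the quotient is traded for elements of `M` itself that generate, and are independent,
modulo `N`. -/
lemma isDGFreeQuotient_iff {M : DGMod A} {N N' : Submodule A.carrier M.carrier} :
    M.IsDGFreeQuotient N N' ↔ ∃ (Y : Type u) (e : Y → M.carrier), (∀ y, e y ∈ N') ∧
      (∀ y, ∃ i, e y ∈ M.deg i) ∧ (∀ y, M.d (e y) ∈ N) ∧
      (∀ x ∈ N', ∃ f, x - Finsupp.linearCombination A.carrier e f ∈ N) ∧
      ∀ f, Finsupp.linearCombination A.carrier e f ∈ N → f = 0 := by
  have key : ∀ {Y : Type u} (e : Y → N') (f : Y →₀ A.carrier),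
      (Finsupp.linearCombination A.carrier e f : M.carrier) =
        Finsupp.linearCombination A.carrier (fun y => (e y : M.carrier)) f := fun e f =>
    Finsupp.apply_linearCombination A.carrier N'.subtype e f
  have key' : ∀ {Y : Type u} (e : Y → N') (f : Y →₀ A.carrier),
      Finsupp.linearCombination A.carrier (fun y => (N.submoduleOf N').mkQ (e y)) f =
        (N.submoduleOf N').mkQ (Finsupp.linearCombination A.carrier e f) := fun e f =>
    (Finsupp.apply_linearCombination A.carrier (N.submoduleOf N').mkQ e f).symm
  have hmk : ∀ x : N', (N.submoduleOf N').mkQ x = 0 ↔ (x : M.carrier) ∈ N := fun x =>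
    Submodule.Quotient.mk_eq_zero _
  constructor
  · rintro ⟨Y, b, hb⟩
    choose e hbe he hd using hb
    have hbe' : (fun y => (N.submoduleOf N').mkQ (e y)) = b := funext hbe
    refine ⟨Y, fun y => e y, fun y => (e y).2, he, hd, fun x hx => ?_, fun f hf => ?_⟩
    · refine ⟨b.repr ((N.submoduleOf N').mkQ ⟨x, hx⟩), ?_⟩
      have := key' e (b.repr ((N.submoduleOf N').mkQ ⟨x, hx⟩))
      rw [hbe', b.linearCombination_repr, ← sub_eq_zero, ← map_sub, hmk] at this
      rwa [AddSubgroupClass.coe_sub, key] at this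
    · rw [← key, ← hmk, ← key', hbe'] at hf
      exact (linearIndependent_iff.1 b.linearIndependent) f hf
  · rintro ⟨Y, e, heN, he, hd, hspan, hli⟩
    let e' : Y → N' := fun y => ⟨e y, heN y⟩
    refine ⟨Y, Module.Basis.mk (v := fun y => (N.submoduleOf N').mkQ (e' y)) ?_ ?_, fun y =>
      ⟨e' y, ?_, he y, hd y⟩⟩
    · rw [linearIndependent_iff]
      intro f hf
      rw [key', hmk, key] at hf
      exact hli f hf
    · rintro x -
      obtain ⟨⟨x, hx⟩, rfl⟩ := Submodule.mkQ_surjective _ x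
      obtain ⟨f, hf⟩ := hspan x hx
      rw [← Finsupp.range_linearCombination]
      refine ⟨f, ?_⟩
      rw [key', eq_comm, ← sub_eq_zero, ← map_sub, hmk, AddSubgroupClass.coe_sub, key]
      exact hf
    · rw [Module.Basis.mk_apply]

lemma isDGFreeQuotient_self (M : DGMod A) (N : Submodule A.carrier M.carrier) :
    M.IsDGFreeQuotient N N :=
  isDGFreeQuotient_iff.2 ⟨PEmpty, PEmpty.elim, fun y => y.elim, fun y => y.elim, fun y => y.elim,
    fun x hx => ⟨0, by simpa using hx⟩, fun _ _ => Subsingleton.elim _ _⟩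

lemma isDGSubmodule_top (M : DGMod A) : M.IsDGSubmodule ⊤ := ⟨fun _ _ _ => trivial, fun _ _ => trivial⟩

/-- `M` has a semi-free filtration which reaches `M` after at most `n` steps. -/
def HasFiltration (M : DGMod A) (n : ℕ) : Prop := ∃ Φ, M.IsSemifreeFiltration Φ ∧ Φ n = ⊤

lemma hasFiltration_zero : (zero A).HasFiltration 0 := by
  refine ⟨fun _ => ⊤, ⟨Subsingleton.elim _ _, monotone_const, fun _ => isDGSubmodule_top _,
    fun _ => ⟨0, trivial⟩, fun _ => isDGFreeQuotient_self _ _⟩, rfl⟩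

lemma HasFiltration.attach {M : DGMod A} {n : ℕ} (h : M.HasFiltration n) {Y : Type u} (δ : Y → ℤ)
    (z : Y → M.carrier) (hz : ∀ y, z y ∈ M.deg (δ y + 1)) (hdz : ∀ y, M.d (z y) = 0) :
    (M.attach δ z hz hdz).HasFiltration (n + 1) := by
  obtain ⟨Φ, hΦ, hn⟩ := h
  let E : DGMod A := M.attach δ z hz hdz
  -- The old filtration up to index `n`, where it already fills `M`; then everything. The only new
  -- subquotient, at index `n`, is free on the attached generators.
  let Ψ : ℕ → Submodule A.carrier E.carrier := fun i =>
    if i ≤ n then (Φ i).prod ⊥ else ⊤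
  have hle : ∀ {i}, i ≤ n → Ψ i = (Φ i).prod ⊥ := fun h => if_pos h
  have hgt : ∀ {i}, n < i → Ψ i = ⊤ := fun h => if_neg (by omega)
  have hd : ∀ m, E.d ((m, 0) : M.carrier × (Y →₀ A.carrier)) = (M.d m, 0) := fun m => by
    simp [E]
  refine ⟨Ψ, ⟨?_, ?_, fun i => ?_, fun x => ⟨n + 1, ?_⟩, fun i => ?_⟩, hgt (by omega)⟩
  · rw [hle (by omega), hΦ.bot, Submodule.prod_bot]
  · intro i j hij
    by_cases h : j ≤ n
    · rw [hle h, hle (hij.trans h)]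
      exact Submodule.prod_mono (hΦ.mono hij) le_rfl
    · rw [hgt (not_le.1 h)]
      exact le_top
  · by_cases h : i ≤ n
    · rw [hle h]
      constructor
      · rintro j ⟨m, g⟩ ⟨hm, rfl : g = 0⟩
        let fst : GradedMod.Hom E.toGradedMod M.toGradedMod :=
          ⟨LinearMap.fst _ _ _, fun _ _ h => h.1⟩
        let snd : GradedMod.Hom E.toGradedMod (GradedMod.free A.toGradedAlg δ) :=
          ⟨LinearMap.snd _ _ _, fun _ _ h => h.2⟩
        refine ⟨?_, ?_⟩
        · have := fst.comp_map j (m, 0)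
          exact (Eq.mp (congrArg (· ∈ Φ i) this) ((hΦ.dgSubmodule i).1 j m hm))
        · have := snd.comp_map j (m, 0)
          exact this.symm.trans (map_zero _)
      · rintro ⟨m, g⟩ ⟨hm, rfl : g = 0⟩
        rw [hd]
        exact ⟨(hΦ.dgSubmodule i).2 m hm, rfl⟩
    · rw [hgt (not_le.1 h)]
      exact isDGSubmodule_top _
  · rw [hgt (by omega)]
    trivial
  · rcases lt_trichotomy i n with h | rfl | h
    · rw [hle h.le, hle h]
      obtain ⟨X, e, heN, he, hde, hspan, hli⟩ := isDGFreeQuotient_iff.1 (hΦ.free i)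
      have hlc : ∀ f, Finsupp.linearCombination A.carrier
          (fun y => ((e y, 0) : M.carrier × (Y →₀ A.carrier))) f =
            (Finsupp.linearCombination A.carrier e f, 0) := fun f =>
        (Finsupp.apply_linearCombination A.carrier (LinearMap.inl _ _ _) e f).symm
      refine isDGFreeQuotient_iff.2 ⟨X, fun y => (e y, 0), fun y => ⟨heN y, rfl⟩, fun y => ?_,
        fun y => ?_, ?_, fun f hf => ?_⟩
      · obtain ⟨j, hj⟩ := he y
        exact ⟨j, hj, zero_mem _⟩
      · rw [hd]
        exact ⟨hde y, rfl⟩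
      · rintro ⟨m, g⟩ ⟨hm, rfl : g = 0⟩
        obtain ⟨f, hf⟩ := hspan m hm
        refine ⟨f, ?_⟩
        rw [hlc]
        exact ⟨hf, by simp⟩
      · rw [hlc] at hf
        exact hli f hf.1
    · rw [hle le_rfl, hgt (by omega), hn]
      have hlc : ∀ f, Finsupp.linearCombination A.carrier
          (fun y => ((0, Finsupp.single y 1) : M.carrier × (Y →₀ A.carrier))) f = (0, f) :=
        fun f => by
          refine (Finsupp.apply_linearCombination A.carrier (LinearMap.inr _ M.carrier _)
            (fun y => Finsupp.single y 1) f).symm.trans ?_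
          rw [LinearMap.inr_apply, Finsupp.linearCombination_apply]
          simp
      refine isDGFreeQuotient_iff.2 ⟨Y, fun y => (0, Finsupp.single y 1), fun _ => trivial,
        fun y => ⟨δ y, zero_mem _, GradedMod.single_one_mem_freeDeg y⟩, fun y => ⟨trivial, ?_⟩, ?_,
        fun f hf => ?_⟩
      · simp [A.d_one]
      · rintro ⟨m, g⟩ -
        refine ⟨g, ?_⟩
        rw [hlc]
        exact ⟨trivial, by simp⟩
      · rw [hlc] at hf
        exact hf.2
    · rw [hgt h, hgt (by omega)]
      exact isDGFreeQuotient_self _ _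

lemma HasFiltration.isSemifree {M : DGMod A} {n : ℕ} (h : M.HasFiltration n) : M.IsSemifree :=
  ⟨_, h.choose_spec.1⟩

/-- A repeated term of a filtration can be left out. -/
lemma IsSemifreeFiltration.skip {M : DGMod A} {Φ : ℕ → Submodule A.carrier M.carrier}
    (hΦ : M.IsSemifreeFiltration Φ) {i : ℕ} (hi : Φ i = Φ (i + 1)) :
    M.IsSemifreeFiltration fun j => if j ≤ i then Φ j else Φ (j + 1) := by
  refine ⟨by simp [hΦ.bot], fun a b hab => ?_, fun j => ?_, fun x => ?_, fun j => ?_⟩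
  · split_ifs with h1 h2 h2
    · exact hΦ.mono hab
    · exact hΦ.mono (by omega)
    · omega
    · exact hΦ.mono (by omega)
  · split_ifs <;> exact hΦ.dgSubmodule _
  · obtain ⟨j, hj⟩ := hΦ.exhaustive x
    refine ⟨j, ?_⟩
    split_ifs
    · exact hj
    · exact hΦ.mono (by omega) hj
  · rcases lt_trichotomy j i with h | rfl | h
    · rw [if_pos h.le, if_pos (by omega)]
      exact hΦ.free j
    · rw [if_pos le_rfl, if_neg (by omega), hi]
      exact hΦ.free _
    · rw [if_neg (by omega), if_neg (by omega)]
      exact hΦ.free _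

/-- The index shift makes `Φ (n + 1)` the submodule `F(n)`, so `n + 1` layers mean length `n`. A
filtration with the least number of layers is strict, as a repeated term could be left out; at `n =
0` the zero module is covered by the convention on its length. -/
lemma HasFiltration.dgFreeClass_le {M : DGMod A} {n : ℕ} (h : M.HasFiltration (n + 1)) :
    M.dgFreeClass ≤ n := by
  induction n with
  | zero =>
    obtain ⟨Φ, hΦ, hn⟩ := h
    refine iInf₂_le 0 ⟨Φ, hΦ, fun i hi h => ?_, hn, fun h => absurd rfl h⟩
    cases i with
    | zero => exact hi (h.trans hn)
    | succ i => exact hi (eq_top_iff.2 (hn ▸ hΦ.mono (by omega)))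
  | succ n ih =>
    by_cases hM : M.HasFiltration (n + 1)
    · exact (ih hM).trans (by exact_mod_cast n.le_succ)
    · obtain ⟨Φ, hΦ, hn⟩ := h
      refine iInf₂_le (n + 1) ⟨Φ, hΦ, fun i hi h => hM ?_, hn, fun _ h => hM ⟨Φ, hΦ, h⟩⟩
      refine ⟨_, hΦ.skip h, (if_neg fun hni => hi ?_).trans hn⟩
      rw [h]
      exact eq_top_iff.2 (hn ▸ hΦ.mono (by omega))

end DGMod

/-! ### Upper bound: free resolutions of cohomology realised by semi-free modules. -/

namespace DGMod

variable {k : Type u} [Field k] {A : DGAlg k}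

/-- A DG module whose cohomology has projective dimension at most two has a semi-free resolution
with a filtration of three steps. -/
lemma exists_resolution_hasFiltration (M : DGMod A) (hM : M.cohomology.projDim ≤ 2) :
    ∃ F : DGMod A, F.HasFiltration 3 ∧ ∃ f : Hom F M, f.IsQuasiIso := by
  obtain ⟨Y₀, Y₁, Y₂, δ₀, δ₁, δ₂, ε, β, α, hε, hβ, hα, hinj⟩ :=
    GradedMod.exists_standard_free_resolution hM
  -- Homogeneous cocycles representing the images of basis elements: `m` for `ε`, `z` for `β`, `g`
  -- for `α`. The maps `lm`, `lz`, `lg` below are the corresponding maps over `A`.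
  have h₀ := fun y => M.mem_cohomology_deg.1
    (ε.map_deg _ _ (GradedMod.single_one_mem_freeDeg (B := A.cohomology) (δ := δ₀) y))
  choose m hm hmε using h₀
  have h₁ := fun y => A.exists_finsuppCls_eq_of_mem
    (β.map_deg _ _ (GradedMod.single_one_mem_freeDeg (B := A.cohomology) (δ := δ₁) y))
  choose z hz hzβ using h₁
  have h₂ := fun y => A.exists_finsuppCls_eq_of_mem
    (α.map_deg _ _ (GradedMod.single_one_mem_freeDeg (B := A.cohomology) (δ := δ₂) y))
  choose g hg hgα using h₂
  have hε' : ∀ x, ε.toLin x = Finsupp.linearCombination _ (fun y => M.hcls (m y)) x := fun x => by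
    simp only [hmε]
    exact LinearMap.congr_fun (g := Finsupp.linearCombination _ _)
      (Finsupp.lhom_ext' fun y => LinearMap.ext_ring (by simp)) x
  have hβ' : ∀ x, β.toLin x = Finsupp.linearCombination _ (fun y => A.finsuppCls Y₀ (z y)) x :=
    fun x => by
      simp only [hzβ]
      exact LinearMap.congr_fun (g := Finsupp.linearCombination _ _)
        (Finsupp.lhom_ext' fun y => LinearMap.ext_ring (by simp)) x
  have hα' : ∀ x, α.toLin x = Finsupp.linearCombination _ (fun y => A.finsuppCls Y₁ (g y)) x :=
    fun x => by
      simp only [hgα]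
      exact LinearMap.congr_fun (g := Finsupp.linearCombination _ _)
        (Finsupp.lhom_ext' fun y => LinearMap.ext_ring (by simp)) x
  -- the first step
  let F₁ : DGMod A := (zero A).attach δ₀ (fun _ => 0) (fun _ => zero_mem _) (fun _ => rfl)
  let f₁ : Hom F₁ M := (zero A).attachLift δ₀ _ _ _ (fromZero M) (fun y => (m y).1) hm
    (fun y => (m y).2)
  let lm := Finsupp.linearCombination A.carrier fun y => (m y).1
  let lz := Finsupp.linearCombination A.carrier fun y => (z y).1
  let lg := Finsupp.linearCombination A.carrier fun y => (g y).1
  have hd₁ : ∀ u x, F₁.d (u, x) = (0, A.finsuppD Y₀ x) := fun u x => rfl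
  have hf₁ : ∀ u x, f₁.toLin (u, x) = lm x := fun _ _ => zero_add _
  have hlm : ∀ x, M.d (lm x) = lm (A.finsuppD Y₀ x) := M.d_linearCombination_cocycle m
  have hlz : ∀ x, A.finsuppD Y₀ (lz x) = lz (A.finsuppD Y₁ x) := A.finsuppD_linearCombination z
  have hlg : ∀ x, A.finsuppD Y₁ (lg x) = lg (A.finsuppD Y₂ x) := A.finsuppD_linearCombination g
  have hεx : ∀ x : LinearMap.ker (A.finsuppD Y₀), ∀ c : LinearMap.ker M.d, c.1 = lm x.1 →
      ε.toLin (A.finsuppCls Y₀ x) = M.hcls c := fun x c hc => by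
    rw [hε', M.hcls_linearCombination m x hc]
  have hβx : ∀ x : LinearMap.ker (A.finsuppD Y₁), ∀ c : LinearMap.ker (A.finsuppD Y₀),
      c.1 = lz x.1 → β.toLin (A.finsuppCls Y₁ x) = A.finsuppCls Y₀ c := fun x c hc => by
    rw [hβ', A.finsuppCls_linearCombination z x hc]
  have hαx : ∀ x : LinearMap.ker (A.finsuppD Y₂), ∀ c : LinearMap.ker (A.finsuppD Y₁),
      c.1 = lg x.1 → α.toLin (A.finsuppCls Y₂ x) = A.finsuppCls Y₁ c := fun x c hc => by
    rw [hα', A.finsuppCls_linearCombination g x hc]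
  have hDz : ∀ y, A.finsuppD Y₀ (z y).1 = 0 := fun y => (z y).2
  have hDg : ∀ y, A.finsuppD Y₁ (g y).1 = 0 := fun y => (g y).2
  -- the second step
  have hw₁ : ∀ y, ∃ w ∈ M.deg (δ₁ y - 1), M.d w = f₁.toLin (0, (z y).1) := fun y => by
    apply M.exists_mem_deg_d_eq
    · rw [sub_add_cancel]
      exact f₁.map_deg _ _ ⟨zero_mem _, hz y⟩
    · have hc : M.d (f₁.toLin (0, (z y).1)) = 0 := by rw [hf₁, hlm, hDz, map_zero]
      -- `ε ∘ β = 0` makes the image of `z y` in `M` a boundary, so `f₁` extends over the new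
      -- generators.
      refine (M.hcls_eq_zero_iff (m := ⟨_, hc⟩)).1 ?_
      rw [← hεx (z y) ⟨_, hc⟩ (hf₁ _ _), hzβ]
      exact (hβ _).2 ⟨_, rfl⟩
  choose w₁ hw₁ hdw₁ using hw₁
  let F₂ : DGMod A := F₁.attach (fun y => δ₁ y - 1) (fun y => (0, (z y).1))
    (fun y => ⟨zero_mem _, by rw [sub_add_cancel]; exact hz y⟩)
    (fun y => by rw [hd₁, hDz]; rfl)
  let f₂ : Hom F₂ M := F₁.attachLift _ _ _ _ f₁ w₁ hw₁ hdw₁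
  have hlcz : ∀ x, Finsupp.linearCombination A.carrier
      (fun y => ((0, (z y).1) : (zero A).carrier × (Y₀ →₀ A.carrier))) x = (0, lz x) := fun x =>
    (Finsupp.apply_linearCombination A.carrier (LinearMap.inr _ (zero A).carrier _)
      (fun y => (z y).1) x).symm
  have hf₂ : ∀ v y, f₂.toLin (v, y) = f₁.toLin v + Finsupp.linearCombination A.carrier w₁ y :=
    fun v y => rfl
  have hd₂ : ∀ u x y, F₂.d ((u, x), y) =
      ((0, A.finsuppD Y₀ x + lz (A.finsuppSgn Y₁ y)), A.finsuppD Y₁ y) := fun u x y => by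
    change (F₁.d (u, x) + Finsupp.linearCombination A.carrier
      (fun y => ((0, (z y).1) : (zero A).carrier × (Y₀ →₀ A.carrier))) (A.finsuppSgn Y₁ y), _) = _
    rw [hlcz, hd₁]
    exact Prod.ext (Prod.ext rfl rfl) rfl
  -- the third step
  have ht : ∀ y, ∃ x ∈ GradedMod.freeDeg A.toGradedAlg δ₀ (δ₂ y - 1),
      A.finsuppD Y₀ x + lz (g y).1 = 0 ∧
        ∃ w ∈ M.deg (δ₂ y - 2), M.d w = f₂.toLin ((0, x), A.finsuppSgn Y₁ (g y).1) := fun y => by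
    have hzg : lz (g y).1 ∈ GradedMod.freeDeg A.toGradedAlg δ₀ (δ₂ y) :=
      GradedMod.linearCombination_mem (N := GradedMod.free A.toGradedAlg δ₀) (l := 0) (δ := δ₁)
        (by simpa using hz) (hg y) (by simp)
    have hDzg : A.finsuppD Y₀ (lz (g y).1) = 0 := by rw [hlz, hDg, map_zero]
    -- `β ∘ α = 0`: so `lz (g y)` bounds some `x'`, and `(-x', sgn (g y))` is a cocycle of `F₂`. The
    -- sign cancels the one in the differential of attached generators.
    have h0 : A.finsuppCls Y₀ ⟨_, hDzg⟩ = 0 := by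
      rw [← hβx (g y) ⟨_, hDzg⟩ rfl, hgα]
      exact (hα _).2 ⟨_, rfl⟩
    obtain ⟨x, hx⟩ := A.finsuppCls_eq_zero_iff.1 h0
    obtain ⟨⟨u, x'⟩, hx', hdx'⟩ := F₁.exists_mem_deg_d_eq (i := δ₂ y - 1) (m := (0, lz (g y).1))
      ⟨zero_mem _, by rw [sub_add_cancel]; exact hzg⟩ ⟨(0, x), by rw [hd₁, hx]⟩
    rw [hd₁] at hdx'
    have hdx'' : A.finsuppD Y₀ x' = lz (g y).1 := congrArg Prod.snd hdx'
    have hmem : ((0, -x'), A.finsuppSgn Y₁ (g y).1) ∈ F₂.deg (δ₂ y - 1) := by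
      refine ⟨⟨zero_mem _, neg_mem hx'.2⟩, fun j => ?_⟩
      have := A.finsuppSgn_mem (hg y) j
      rwa [show δ₂ y - 1 - (δ₁ j - 1) = δ₂ y - δ₁ j by ring]
    have hcoc : F₂.d ((0, -x'), A.finsuppSgn Y₁ (g y).1) = 0 := by
      rw [hd₂, A.finsuppSgn_finsuppSgn, A.finsuppD_finsuppSgn, map_neg, hdx'', hDg, map_zero,
        neg_zero, neg_add_cancel]
      rfl
    have hcoc' : M.d (f₂.toLin ((0, -x'), A.finsuppSgn Y₁ (g y).1)) = 0 := by
      rw [← f₂.comm, hcoc, map_zero]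
    -- The image of this cocycle in `M` may have a nonzero class, which would prevent `f₂` from
    -- extending. By surjectivity of `ε` the class comes from a cocycle `r` over `Y₀`; subtracting
    -- `r` kills it and leaves the `Y₁`-component unchanged.
    obtain ⟨v, hv, hvε⟩ := ε.exists_mem_deg (n := M.hcls ⟨_, hcoc'⟩) (i := δ₂ y - 1)
      ⟨_, f₂.map_deg _ _ hmem, rfl⟩ (hε _)
    obtain ⟨r, hr, rfl⟩ := A.exists_finsuppCls_eq_of_mem hv
    have hDr : A.finsuppD Y₀ r.1 = 0 := r.2
    have hr' : M.d (lm r.1) = 0 := by rw [hlm, hDr, map_zero]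
    rw [hεx r ⟨_, hr'⟩ rfl, eq_comm, ← sub_eq_zero, ← map_sub, M.hcls_eq_zero_iff] at hvε
    have hfr : f₂.toLin ((0, -x' - r.1), A.finsuppSgn Y₁ (g y).1) =
        f₂.toLin ((0, -x'), A.finsuppSgn Y₁ (g y).1) - lm r.1 := by
      rw [hf₂, hf₂, hf₁, hf₁, map_sub]
      abel
    refine ⟨-x' - r.1, sub_mem (neg_mem hx'.2) hr, ?_, M.exists_mem_deg_d_eq ?_ ?_⟩
    · simp [hdx'', hDr]
    · rw [show δ₂ y - 2 + 1 = δ₂ y - 1 by ring]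
      exact f₂.map_deg _ _ ⟨⟨zero_mem _, sub_mem (neg_mem hx'.2) hr⟩, hmem.2⟩
    · rw [hfr]
      exact hvε
  choose x hx hxz w₂ hw₂ hdw₂ using ht
  let t : Y₂ → F₂.carrier := fun y => ((0, x y), A.finsuppSgn Y₁ (g y).1)
  let F₃ : DGMod A := F₂.attach (fun y => δ₂ y - 2) t
    (fun y => by
      rw [show δ₂ y - 2 + 1 = δ₂ y - 1 by ring]
      refine ⟨⟨zero_mem _, hx y⟩, fun j => ?_⟩
      have := A.finsuppSgn_mem (hg y) j
      rwa [show δ₂ y - 1 - (δ₁ j - 1) = δ₂ y - δ₁ j by ring])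
    (fun y => by
      simp only [t]
      rw [hd₂, A.finsuppSgn_finsuppSgn, hxz, A.finsuppD_finsuppSgn, hDg, map_zero, neg_zero]
      rfl)
  let f₃ : Hom F₃ M := F₂.attachLift _ _ _ _ f₂ w₂ hw₂ hdw₂
  have hsgn : ∀ h : Y₂ →₀ A.carrier, Finsupp.linearCombination A.carrier
      (fun y => A.finsuppSgn Y₁ (g y).1) (A.finsuppSgn Y₂ h) = A.finsuppSgn Y₁ (lg h) := fun h => by
    induction h using Finsupp.induction_linear with
    | zero => simp
    | add a b ha hb => simp only [map_add, ha, hb]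
    | single y a => simp [lg, A.finsuppSgn_smul]
  have hlct : ∀ h : Y₂ →₀ A.carrier, (Finsupp.linearCombination A.carrier t (A.finsuppSgn Y₂ h)).2 =
      A.finsuppSgn Y₁ (lg h) := fun h => by
    rw [← hsgn]
    exact Finsupp.apply_linearCombination A.carrier (LinearMap.snd _ _ _) t (A.finsuppSgn Y₂ h)
  have hd₃ : ∀ v h, F₃.d (v, h) =
      (F₂.d v + Finsupp.linearCombination A.carrier t (A.finsuppSgn Y₂ h), A.finsuppD Y₂ h) :=
    fun v h => rfl
  have hd₃' : ∀ v h, (F₃.d (v, h)).1.2 = A.finsuppD Y₁ v.2 + A.finsuppSgn Y₁ (lg h) :=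
    fun v h => by
      rw [← hlct]
      rfl
  have hd₃₀ : ∀ v, F₃.d (v, 0) = (F₂.d v, 0) := fun v => by
    rw [hd₃, map_zero, map_zero, map_zero, add_zero]
  have hf₃ : ∀ v, f₃.toLin (v, 0) = f₂.toLin v := fun v => by
    change f₂.toLin v + Finsupp.linearCombination A.carrier w₂ 0 = _
    rw [map_zero, add_zero]
  have hf₃₀ : ∀ u c, f₃.toLin (((u, c), 0), 0) = lm c := fun u c => by
    rw [hf₃, hf₂, map_zero, add_zero, hf₁]
  refine ⟨F₃, ((hasFiltration_zero.attach _ _ _ _).attach _ _ _ _).attach _ _ _ _, f₃,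
    f₃.isQuasiIso_iff.2 ⟨?_, fun n hn => ?_⟩⟩
  -- Injectivity on cohomology. A cocycle with null image is pushed down the layers modulo
  -- boundaries: injectivity of `α` clears the `Y₂`-component, exactness at `G₁` the `Y₁`-component
  -- (`step₂`), and exactness at `G₀` settles what is left in `F₁` (`step₁`).
  · have step₁ : ∀ v : F₁.carrier, F₃.d ((v, 0), 0) = 0 → (∃ n, M.d n = f₃.toLin ((v, 0), 0)) →
        ∃ y, F₃.d y = ((v, 0), 0) := by
      rintro ⟨u, c⟩ hdc hn
      have hDc : A.finsuppD Y₀ c = 0 := by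
        rw [hd₃₀, hd₂, map_zero, map_zero, add_zero] at hdc
        exact congrArg (fun v => v.1.1.2) hdc
      rw [hf₃₀] at hn
      have hc0 : M.d (lm c) = 0 := by rw [hlm, hDc, map_zero]
      have hεc : ε.toLin (A.finsuppCls Y₀ ⟨c, hDc⟩) = 0 := by
        rw [hεx ⟨c, hDc⟩ ⟨_, hc0⟩ rfl]
        exact M.hcls_eq_zero_iff.2 hn
      obtain ⟨b, hb⟩ := (hβ _).1 hεc
      obtain ⟨b, rfl⟩ := A.exists_finsuppCls_eq b
      have hDb : A.finsuppD Y₁ b.1 = 0 := b.2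
      have hzb : A.finsuppD Y₀ (lz b.1) = 0 := by rw [hlz, hDb, map_zero]
      rw [hβx b ⟨_, hzb⟩ rfl, eq_comm, ← sub_eq_zero, ← map_sub, A.finsuppCls_eq_zero_iff] at hb
      obtain ⟨a, ha⟩ := hb
      refine ⟨(((0, a), A.finsuppSgn Y₁ b.1), 0), ?_⟩
      rw [hd₃₀, hd₂, ha, A.finsuppSgn_finsuppSgn, A.finsuppD_finsuppSgn, hDb, map_zero, neg_zero]
      exact Prod.ext (Prod.ext (Prod.ext rfl (sub_add_cancel _ _)) rfl) rfl
    have step₂ : ∀ v : F₂.carrier, F₃.d (v, 0) = 0 → (∃ n, M.d n = f₃.toLin (v, 0)) →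
        ∃ y, F₃.d y = (v, 0) := by
      rintro ⟨⟨u, c⟩, b⟩ hdc hn
      have hdc' := hdc
      rw [hd₃₀, hd₂] at hdc
      have hDb : A.finsuppD Y₁ b = 0 := congrArg (fun v => v.1.2) hdc
      have hDc : A.finsuppD Y₀ c + lz (A.finsuppSgn Y₁ b) = 0 :=
        congrArg (fun v => v.1.1.2) hdc
      have hDσb : A.finsuppD Y₁ (A.finsuppSgn Y₁ b) = 0 := by simp [hDb]
      have hzb : A.finsuppD Y₀ (lz (A.finsuppSgn Y₁ b)) = 0 := by rw [hlz, hDσb, map_zero]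
      have hβb : β.toLin (A.finsuppCls Y₁ ⟨_, hDσb⟩) = 0 := by
        rw [hβx ⟨_, hDσb⟩ ⟨_, hzb⟩ rfl, A.finsuppCls_eq_zero_iff]
        exact ⟨-c, by rw [map_neg, eq_comm]; exact eq_neg_of_add_eq_zero_right hDc⟩
      obtain ⟨h, hh⟩ := (hα _).1 hβb
      obtain ⟨h, rfl⟩ := A.exists_finsuppCls_eq h
      have hDh : A.finsuppD Y₂ h.1 = 0 := h.2
      have hDgh : A.finsuppD Y₁ (lg h.1) = 0 := by rw [hlg, hDh, map_zero]
      rw [hαx h ⟨_, hDgh⟩ rfl, eq_comm, ← sub_eq_zero, ← map_sub, A.finsuppCls_eq_zero_iff] at hh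
      obtain ⟨a, ha⟩ := hh
      have ha : A.finsuppD Y₁ a = A.finsuppSgn Y₁ b - lg h.1 := ha
      have hb : b = A.finsuppSgn Y₁ (lg h.1) - A.finsuppD Y₁ (A.finsuppSgn Y₁ a) := by
        rw [A.finsuppD_finsuppSgn, ha]
        simp
      -- The class of `sgn b` is the image of that of `h` under `α`, up to the boundary of `a`; both
      -- contributions to `b` are removed by subtracting `d e`.
      let e : F₃.carrier := (((0, 0), -A.finsuppSgn Y₁ a), h.1)
      have he : ∃ v : F₁.carrier, (((u, c), b), 0) - F₃.d e = ((v, 0), 0) := by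
        refine ⟨((((u, c), b), 0) - F₃.d e).1.1, Prod.ext (Prod.ext rfl ?_) ?_⟩
        · change b - (F₃.d e).1.2 = 0
          rw [hd₃', map_neg]
          nth_rw 1 [hb]
          abel
        · change 0 - A.finsuppD Y₂ h.1 = 0
          rw [hDh, sub_zero]
      obtain ⟨v, hv⟩ := he
      obtain ⟨y, hy⟩ := step₁ v (by rw [← hv, map_sub, hdc', F₃.d_d, sub_zero]) (by
        obtain ⟨n, hn⟩ := hn
        exact ⟨n - f₃.toLin e, by rw [← hv, map_sub, map_sub, hn, f₃.comm]⟩)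
      exact ⟨y + e, by rw [map_add, hy, ← hv, sub_add_cancel]⟩
    rintro ⟨v, h⟩ hdv hn
    obtain ⟨⟨u, c⟩, b⟩ := v
    have hDh : A.finsuppD Y₂ h = 0 := congrArg Prod.snd hdv
    have hDb : A.finsuppD Y₁ b + A.finsuppSgn Y₁ (lg h) = 0 :=
      (hd₃' ((u, c), b) h).symm.trans (congrArg (fun v => v.1.2) hdv)
    have hDgh : A.finsuppD Y₁ (lg h) = 0 := by rw [hlg, hDh, map_zero]
    have hαh : α.toLin (A.finsuppCls Y₂ ⟨h, hDh⟩) = 0 := by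
      rw [hαx ⟨h, hDh⟩ ⟨_, hDgh⟩ rfl, A.finsuppCls_eq_zero_iff]
      refine ⟨A.finsuppSgn Y₁ b, ?_⟩
      rw [A.finsuppD_finsuppSgn, ← map_neg, neg_eq_of_add_eq_zero_right hDb,
        A.finsuppSgn_finsuppSgn]
    have hh := hinj (hαh.trans (map_zero _).symm)
    obtain ⟨a, ha⟩ := A.finsuppCls_eq_zero_iff.1 hh
    have ha : A.finsuppD Y₂ a = h := ha
    let e : F₃.carrier := (0, a)
    obtain ⟨v, hv⟩ : ∃ v : F₂.carrier, (((u, c), b), h) - F₃.d e = (v, 0) := by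
      refine ⟨((((u, c), b), h) - F₃.d e).1, Prod.ext rfl ?_⟩
      change h - A.finsuppD Y₂ a = 0
      rw [ha, sub_self]
    obtain ⟨y, hy⟩ := step₂ v (by rw [← hv, map_sub, hdv, F₃.d_d, sub_zero]) (by
      obtain ⟨n, hn⟩ := hn
      exact ⟨n - f₃.toLin e, by rw [← hv, map_sub, map_sub, hn, f₃.comm]⟩)
    exact ⟨y + e, by rw [map_add, hy, ← hv, sub_add_cancel]⟩
  -- Surjectivity on cohomology already holds on the first layer, because `ε` is surjective.
  · obtain ⟨c, hc⟩ := hε (M.hcls ⟨n, hn⟩)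
    obtain ⟨r, rfl⟩ := A.exists_finsuppCls_eq c
    have hDr : A.finsuppD Y₀ r.1 = 0 := r.2
    have hr' : M.d (lm r.1) = 0 := by rw [hlm, hDr, map_zero]
    rw [hεx r ⟨_, hr'⟩ rfl, ← sub_eq_zero, ← map_sub, M.hcls_eq_zero_iff] at hc
    refine ⟨(((0, r.1), 0), 0), ?_, ?_⟩
    · rw [hd₃₀, hd₂, hDr, map_zero, map_zero, map_zero, add_zero]
      rfl
    · rw [hf₃₀]
      exact hc

lemma coneLength_le_two (M : DGMod A) (hM : M.cohomology.projDim ≤ 2) : M.coneLength ≤ 2 := by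
  obtain ⟨F, hF, hf⟩ := M.exists_resolution_hasFiltration hM
  exact (iInf₂_le F ⟨hF.isSemifree, hf⟩).trans hF.dgFreeClass_le

end DGMod

/-! ### Connected graded algebras with projective augmentation ideal. -/

/-- A form of Schanuel's lemma. -/
lemma Module.Projective.ker_of_ker {R P Q M : Type*} [Ring R] [AddCommGroup P] [AddCommGroup Q]
    [AddCommGroup M] [Module R P] [Module R Q] [Module R M] [Module.Projective R P]
    [Module.Projective R Q] (f : P →ₗ[R] M) (g : Q →ₗ[R] M) (hf : Function.Surjective f)
    (hg : Function.Surjective g) [Module.Projective R (LinearMap.ker f)] :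
    Module.Projective R (LinearMap.ker g) := by
  obtain ⟨s, hs⟩ := Module.projective_lifting_property g f hg
  obtain ⟨t, ht⟩ := Module.projective_lifting_property f g hf
  have hs' : ∀ x, g (s x) = f x := fun x => LinearMap.congr_fun hs x
  have ht' : ∀ x, f (t x) = g x := fun x => LinearMap.congr_fun ht x
  -- `ker g` is a retract of `Q × ker f`, through `x ↦ (x, t x)` and `(q, p) ↦ q - s (t q) + s p`.
  let i : LinearMap.ker g →ₗ[R] Q × LinearMap.ker f :=
    (LinearMap.ker g).subtype.prod ((t ∘ₗ (LinearMap.ker g).subtype).codRestrict _ fun x => by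
      simp [ht'])
  let r : Q × LinearMap.ker f →ₗ[R] LinearMap.ker g :=
    ((LinearMap.id - s ∘ₗ t).coprod (s ∘ₗ (LinearMap.ker f).subtype)).codRestrict _ fun x => by
      simp [hs', ht']
  refine Module.Projective.of_split i r (LinearMap.ext fun x => Subtype.ext ?_)
  change (x : Q) - s (t x) + s (t x) = x
  rw [sub_add_cancel]

namespace GradedAlg

variable {k : Type u} [Field k] (B : GradedAlg k)

lemma comp_mul_of_mem {e n : ℕ} (a : B.carrier) {v : B.carrier} (hv : v ∈ B.deg e) :
    B.comp n (a * v) = if e ≤ n then B.comp (n - e) a * v else 0 := by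
  induction a using DirectSum.Decomposition.inductionOn B.deg with
  | zero => simp
  | add a b ha hb =>
    rw [add_mul, map_add, ha, hb]
    split_ifs <;> simp [add_mul]
  | @homogeneous i a =>
    have h := B.mul_mem a.2 hv
    split_ifs with hn
    · by_cases hi : i = n - e
      · have h1 : (a : B.carrier) ∈ B.deg (n - e) := hi ▸ a.2
        have h2 : (a : B.carrier) * v ∈ B.deg n := by rwa [show i + e = n by omega] at h
        rw [B.comp_of_mem h1, B.comp_of_mem h2]
      · rw [B.comp_of_mem_ne a.2 hi, B.comp_of_mem_ne h (by omega), zero_mul]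
    · exact B.comp_of_mem_ne h (by omega)

lemma comp_mul_algebraMap (n : ℕ) (a : B.carrier) (r : k) :
    B.comp n (a * algebraMap k _ r) = B.comp n a * algebraMap k _ r := by
  rw [B.comp_mul_of_mem a (B.algebraMap_mem r)]
  simp

/-- Here `a` starts in degree `n` or later and `b` in degree one or later, so the product starts
after degree `n`. -/
lemma comp_mul_of_comp_eq_zero {n : ℕ} {a b : B.carrier} (ha : ∀ p < n, B.comp p a = 0)
    (hb : B.comp 0 b = 0) : B.comp n (a * b) = 0 := by
  obtain ⟨s, hs⟩ := B.exists_sum_comp b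
  rw [← hs, Finset.mul_sum, map_sum]
  refine Finset.sum_eq_zero fun q _ => ?_
  rw [B.comp_mul_of_mem a (B.comp_mem q b)]
  split_ifs with h
  · rcases Nat.eq_zero_or_pos q with rfl | hq
    · rw [hb, mul_zero]
    · rw [ha _ (by omega), zero_mul]
  · rfl

/-- The augmentation ideal `⨁_{i > 0} B^i`. -/
noncomputable def augIdeal : Ideal B.carrier where
  carrier := {b | B.comp 0 b = 0}
  add_mem' {a b} ha hb := by
    have ha' : B.comp 0 a = 0 := ha
    have hb' : B.comp 0 b = 0 := hb
    simp [ha', hb']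
  zero_mem' := map_zero _
  smul_mem' a b hb := B.comp_mul_of_comp_eq_zero (by simp) hb

lemma mem_augIdeal {b : B.carrier} : b ∈ B.augIdeal ↔ B.comp 0 b = 0 := Iff.rfl

lemma mem_augIdeal_of_mem {b : B.carrier} {e : ℕ} (h : b ∈ B.deg e) (he : e ≠ 0) :
    b ∈ B.augIdeal := B.comp_of_mem_ne h he

variable {B}

lemma IsConnected.exists_algebraMap_eq (hB : B.IsConnected) {a : B.carrier} (ha : a ∈ B.deg 0) :
    ∃ r, algebraMap k B.carrier r = a := by
  obtain ⟨r, hr⟩ := hB.2 ⟨a, ha⟩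
  exact ⟨r, congrArg Subtype.val hr⟩

/-- Homogeneous elements of positive degree that form a basis of the augmentation ideal as a left
ideal. -/
structure FreeGenerators (B : GradedAlg k) where
  J : Type u
  v : J → B.carrier
  e : J → ℕ
  e_ne_zero : ∀ j, e j ≠ 0
  v_mem : ∀ j, v j ∈ B.deg (e j)
  injective : Function.Injective (Finsupp.linearCombination B.carrier v)
  range_eq : LinearMap.range (Finsupp.linearCombination B.carrier v) = B.augIdeal

/-- The span of the products of two elements of the augmentation ideal. -/
noncomputable def augSq (B : GradedAlg k) : Submodule k B.carrier :=
  B.augIdeal.restrictScalars k * B.augIdeal.restrictScalars k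

-- Homogeneous lifts of a basis of `I/I²`, for `I` the augmentation ideal. They generate `I` by
-- induction on the degree `n`: modulo their span, an element of degree `n` is the degree-`n` part
-- of an element of `I²`, a sum of products whose right factors have degree less than `n`.
variable (B) in
lemma exists_generators :
    ∃ (J : Type u) (v : J → B.carrier) (e : J → ℕ), (∀ j, e j ≠ 0) ∧ (∀ j, v j ∈ B.deg (e j)) ∧
      LinearMap.range (Finsupp.linearCombination B.carrier v) = B.augIdeal ∧
      ∀ c : J →₀ k, Finsupp.linearCombination k v c ∈ B.augSq → c = 0 := by
  let T : Set (B.carrier ⧸ B.augSq) := {x | ∃ i : ℕ, i ≠ 0 ∧ ∃ a ∈ B.deg i, B.augSq.mkQ a = x}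
  obtain ⟨S, hST, hspan, hli⟩ := exists_linearIndependent k T
  choose e he v hv hvS using fun j : S => hST j.2
  have hmem : ∀ b, b ∈ B.augSq ↔ B.augSq.mkQ b = 0 := fun b =>
    (Submodule.Quotient.mk_eq_zero _).symm
  have hvS' : (fun j => B.augSq.mkQ (v j)) = (Subtype.val : S → _) := funext hvS
  have hle : ∀ j, v j ∈ LinearMap.range (Finsupp.linearCombination B.carrier v) := fun j =>
    ⟨Finsupp.single j 1, by simp⟩
  refine ⟨S, v, e, he, hv, le_antisymm ?_ ?_, fun c hc => ?_⟩
  · rintro _ ⟨f, rfl⟩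
    rw [Finsupp.linearCombination_apply]
    exact Submodule.sum_mem _ fun j _ =>
      Ideal.mul_mem_left _ _ (B.mem_augIdeal_of_mem (hv j) (he j))
  · have key : ∀ n, n ≠ 0 → ∀ a ∈ B.deg n,
        a ∈ LinearMap.range (Finsupp.linearCombination B.carrier v) := by
      intro n
      induction n using Nat.strong_induction_on with
      | _ n ih =>
        intro hn a ha
        have h1 : B.augSq.mkQ a ∈ Submodule.span k S := by
          rw [hspan]
          exact Submodule.subset_span ⟨n, hn, a, ha, rfl⟩
        rw [← Subtype.range_coe (s := S), ← hvS', ← Finsupp.range_linearCombination] at h1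
        obtain ⟨c, hc⟩ := h1
        have h2 : a - Finsupp.linearCombination k v c ∈ B.augSq := by
          rw [hmem, map_sub, ← hc,
            Finsupp.apply_linearCombination, sub_eq_zero]
          rfl
        have h3 : ∀ b ∈ B.augSq, B.comp n b ∈
            LinearMap.range (Finsupp.linearCombination B.carrier v) := fun b hb => by
          refine Submodule.mul_induction_on hb (fun x hx y hy => ?_) fun x y hx hy => ?_
          · obtain ⟨s, hs⟩ := B.exists_sum_comp y
            rw [← hs, Finset.mul_sum, map_sum]
            refine Submodule.sum_mem _ fun q _ => ?_
            rw [B.comp_mul_of_mem x (B.comp_mem q y)]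
            split_ifs with hq
            · rcases eq_or_lt_of_le hq with rfl | hq'
              · rw [Nat.sub_self, B.mem_augIdeal.1 hx, zero_mul]
                exact zero_mem _
              · rcases Nat.eq_zero_or_pos q with rfl | hq0
                · rw [B.mem_augIdeal.1 hy, mul_zero]
                  exact zero_mem _
                · exact Ideal.mul_mem_left _ _ (ih q hq' hq0.ne' _ (B.comp_mem q y))
            · exact zero_mem _
          · rw [map_add]
            exact add_mem hx hy
        have h4 : B.comp n (Finsupp.linearCombination k v c) ∈
            LinearMap.range (Finsupp.linearCombination B.carrier v) := by
          rw [Finsupp.linearCombination_apply, Finsupp.sum, map_sum]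
          refine Submodule.sum_mem _ fun j _ => ?_
          rw [map_smul]
          by_cases h : e j = n
          · rw [B.comp_of_mem (h ▸ hv j), Algebra.smul_def]
            exact Ideal.mul_mem_left _ _ (hle j)
          · rw [B.comp_of_mem_ne (hv j) h, smul_zero]
            exact zero_mem _
        have h5 := add_mem (h3 _ h2) h4
        rwa [← map_add, sub_add_cancel, B.comp_of_mem ha] at h5
    intro a ha
    obtain ⟨s, hs⟩ := B.exists_sum_comp a
    rw [← hs]
    refine Submodule.sum_mem _ fun i _ => ?_
    rcases Nat.eq_zero_or_pos i with rfl | hi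
    · rw [B.mem_augIdeal.1 ha]
      exact zero_mem _
    · exact key i hi.ne' _ (B.comp_mem i a)
  · rw [hmem, Finsupp.apply_linearCombination] at hc
    exact linearIndependent_iff.1 hli c (by rw [← hvS']; exact hc)

/-- Graded Nakayama: a section `s` of the projection `p` from the free module on minimal generators
satisfies `s ∘ p = id` modulo positive degrees. This forces `p` to be injective, with no grading
assumed on `s`. -/
lemma IsConnected.exists_freeGenerators (hB : B.IsConnected)
    (h : Module.Projective B.carrier B.augIdeal) : Nonempty (FreeGenerators B) := by
  classical
  obtain ⟨J, v, e, he, hv, hrange, hli⟩ := B.exists_generators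
  refine ⟨⟨J, v, e, he, hv, ?_, hrange⟩⟩
  let p : (J →₀ B.carrier) →ₗ[B.carrier] B.augIdeal :=
    (Finsupp.linearCombination B.carrier v).codRestrict B.augIdeal fun f => hrange ▸ ⟨f, rfl⟩
  have hp : Function.Surjective p := by
    rintro ⟨a, ha⟩
    rw [← hrange] at ha
    obtain ⟨f, rfl⟩ := ha
    exact ⟨f, rfl⟩
  obtain ⟨s, hs⟩ := Module.projective_lifting_property p LinearMap.id hp
  have hs' : ∀ x, Finsupp.linearCombination B.carrier v (s x) = x := fun x =>
    congrArg Subtype.val (LinearMap.congr_fun hs x)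
  -- The difference `g` is a relation among the generators. Its coefficients of degree `0` are
  -- scalars and give a `k`-linear relation modulo `I²`, hence vanish.
  have hr : ∀ j l, B.comp 0 (s (p (Finsupp.single j 1)) l - Finsupp.single j 1 l) = 0 := by
    intro j
    let g : J →₀ B.carrier := s (p (Finsupp.single j 1)) - Finsupp.single j 1
    have hg : Finsupp.linearCombination B.carrier v g = 0 := by
      simp only [g, map_sub, hs']
      exact sub_self _
    choose c hc using fun b : B.carrier => hB.exists_algebraMap_eq (B.comp_mem 0 b)
    have hc0 : ∀ b, B.comp 0 b = 0 → c b = 0 := fun b hb => by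
      have := hc b
      rw [hb, ← map_zero (algebraMap k B.carrier)] at this
      have h1 : algebraMap k (B.deg 0) (c b) = algebraMap k (B.deg 0) 0 := Subtype.ext this
      exact hB.1 h1
    have h1 : Finsupp.linearCombination k v (g.mapRange c (hc0 0 (map_zero _))) ∈ B.augSq := by
      have h2 : Finsupp.linearCombination k v (g.mapRange c (hc0 0 (map_zero _))) =
          -∑ l ∈ g.support, (g l - B.comp 0 (g l)) * v l := by
        rw [Finsupp.linearCombination_apply,
          Finsupp.sum_of_support_subset _ Finsupp.support_mapRange _ (by simp)]
        rw [Finsupp.linearCombination_apply, Finsupp.sum] at hg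
        simp only [sub_mul, Finset.sum_sub_distrib, neg_sub]
        simp only [smul_eq_mul] at hg
        rw [hg, sub_zero]
        exact Finset.sum_congr rfl fun l _ => by
          rw [Finsupp.mapRange_apply, Algebra.smul_def, hc]
      rw [h2]
      refine neg_mem (Submodule.sum_mem _ fun l _ => Submodule.mul_mem_mul ?_
        (B.mem_augIdeal_of_mem (hv l) (he l)))
      change B.comp 0 _ = 0
      rw [map_sub, B.comp_of_mem (B.comp_mem 0 (g l)), sub_self]
    have h3 := hli _ h1
    intro l
    have h4 : c (g l) = 0 := DFunLike.congr_fun h3 l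
    have h5 := hc (g l)
    rw [h4, map_zero] at h5
    exact h5.symm
  rw [injective_iff_map_eq_zero]
  intro f hf
  have hpf : s (p f) = 0 := by
    rw [show p f = 0 from Subtype.ext hf, map_zero]
  -- For `f` in the kernel, each coordinate is a combination of the coordinates of `f` with right
  -- factors of positive degree. So the lowest nonzero component of `f` cannot exist.
  have hf' : ∀ l, f l = -∑ j ∈ f.support, f j * (s (p (Finsupp.single j 1)) l -
      Finsupp.single j (1 : B.carrier) l) := fun l => by
    have h1 : s (p f) - f = f.sum fun j a => a • (s (p (Finsupp.single j 1)) - Finsupp.single j 1) := by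
      conv_lhs => rw [← Finsupp.sum_single f]
      rw [Finsupp.sum, map_sum, map_sum, ← Finset.sum_sub_distrib]
      refine Finset.sum_congr rfl fun j _ => ?_
      change _ = f j • (s _ - _)
      rw [smul_sub, ← map_smul, ← map_smul, Finsupp.smul_single, smul_eq_mul, mul_one]
    rw [hpf, zero_sub] at h1
    have h2 := DFunLike.congr_fun h1 l
    rw [Finsupp.neg_apply, Finsupp.sum, Finsupp.coe_finsetSum, Finset.sum_apply] at h2
    rw [← neg_eq_iff_eq_neg, h2]
    rfl
  have key : ∀ n, ∀ l, B.comp n (f l) = 0 := by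
    intro n
    induction n using Nat.strong_induction_on with
    | _ n ih =>
      intro l
      rw [hf' l, map_neg, map_sum, neg_eq_zero]
      exact Finset.sum_eq_zero fun j _ =>
        B.comp_mul_of_comp_eq_zero (fun p hp => ih p hp j) (hr j l)
  ext l
  exact B.ext_comp fun n => by rw [key, Finsupp.zero_apply, map_zero]

/-- By induction on degree, `B = k ⊕ ∑ B v_j` is reached from `1` by right multiplications with the
generators. -/
lemma FreeGenerators.induction (hB : B.IsConnected) (V : FreeGenerators B)
    (S : Submodule k B.carrier) (h1 : 1 ∈ S) (hmul : ∀ b ∈ S, ∀ j, b * V.v j ∈ S) : S = ⊤ := by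
  have key : ∀ n, ∀ a ∈ B.deg n, a ∈ S := by
    intro n
    induction n using Nat.strong_induction_on with
    | _ n ih =>
      intro a ha
      rcases Nat.eq_zero_or_pos n with rfl | hn
      · obtain ⟨r, rfl⟩ := hB.exists_algebraMap_eq ha
        rw [Algebra.algebraMap_eq_smul_one]
        exact S.smul_mem r h1
      · have h2 := B.mem_augIdeal_of_mem ha hn.ne'
        rw [← V.range_eq] at h2
        obtain ⟨f, hf⟩ := h2
        rw [← B.comp_of_mem ha, ← hf, Finsupp.linearCombination_apply, Finsupp.sum, map_sum]
        refine Submodule.sum_mem _ fun j _ => ?_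
        rw [smul_eq_mul, B.comp_mul_of_mem _ (V.v_mem j)]
        split_ifs
        · have := V.e_ne_zero j
          exact hmul _ (ih (n - V.e j) (by omega) _ (B.comp_mem _ _)) j
        · exact zero_mem _
  rw [eq_top_iff]
  intro a _
  obtain ⟨s, hs⟩ := B.exists_sum_comp a
  rw [← hs]
  exact Submodule.sum_mem _ fun i _ => key i _ (B.comp_mem i a)

/-- If the augmentation ideal is free, then every module has a projective resolution of length
one. -/
lemma FreeGenerators.exists_presentation (hB : B.IsConnected) (V : FreeGenerators B)
    (M : Type u) [AddCommGroup M] [Module k M] [Module B.carrier M] [IsScalarTower k B.carrier M] :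
    ∃ (X : Type u) (π : (X →₀ B.carrier) →ₗ[B.carrier] M), Function.Surjective π ∧
      Module.Projective B.carrier (LinearMap.ker π) := by
  -- The basis `κ` makes `X →₀ B` a model of `B ⊗ M`, with `ι m = 1 ⊗ m` and `π` the action. The
  -- resolution is given by `φ (b ⊗ v_j ⊗ m) = b v_j ⊗ m - b ⊗ v_j m`, where `T` is the second term.
  let κ := Module.Basis.ofVectorSpace k M
  let X := Module.Basis.ofVectorSpaceIndex k M
  let ι : M →ₗ[k] (X →₀ B.carrier) :=
    Finsupp.mapRange.linearMap (Algebra.linearMap k B.carrier) ∘ₗ κ.repr.toLinearMap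
  let π : (X →₀ B.carrier) →ₗ[B.carrier] M := Finsupp.linearCombination B.carrier κ
  let W : (V.J →₀ B.carrier) →ₗ[B.carrier] B.carrier := Finsupp.linearCombination B.carrier V.v
  let U (x : X) : (V.J →₀ B.carrier) →ₗ[B.carrier] (X →₀ B.carrier) :=
    Finsupp.linearCombination B.carrier fun j => ι (V.v j • κ x)
  let T : (X →₀ (V.J →₀ B.carrier)) →ₗ[B.carrier] (X →₀ B.carrier) := Finsupp.lsum ℕ U
  let φ : (X →₀ (V.J →₀ B.carrier)) →ₗ[B.carrier] (X →₀ B.carrier) :=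
    Finsupp.mapRange.linearMap W - T
  have hι : ∀ x r, ι (r • κ x) = Finsupp.single x (algebraMap k _ r) := fun x r => by
    simp [ι, Algebra.algebraMap_eq_smul_one]
  have hπι : ∀ m, π (ι m) = m := fun m => by
    have h : π.restrictScalars k ∘ₗ ι = LinearMap.id := κ.ext fun x => by
      have := hι x 1
      rw [one_smul] at this
      simp [π, this]
    exact LinearMap.congr_fun h m
  have hφ1 : ∀ x b j, φ (Finsupp.single x (Finsupp.single j b)) =
      Finsupp.single x (b * V.v j) - b • ι (V.v j • κ x) := fun x b j => by
    simp [φ, T, U, W]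
  have hπφ : ∀ f, π (φ f) = 0 := fun f => by
    have h : π ∘ₗ φ = 0 := Finsupp.lhom_ext' fun x => Finsupp.lhom_ext fun j b => by
      rw [LinearMap.comp_apply, LinearMap.comp_apply, Finsupp.lsingle_apply, hφ1, map_sub, map_smul,
        hπι, Finsupp.linearCombination_single, mul_smul, sub_self]
      rfl
    exact LinearMap.congr_fun h f
  -- Modulo the image of `φ`, generators move across the tensor sign from `B` to `M`, so every `f`
  -- is congruent to `1 ⊗ π f`; for `f` in `ker π` this is zero.
  have hgen : ∀ f, f - ι (π f) ∈ LinearMap.range φ := by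
    let Q : Submodule k (X →₀ B.carrier) :=
      ((LinearMap.range φ).restrictScalars k).comap (LinearMap.id - ι ∘ₗ π.restrictScalars k)
    have hQφ : ∀ f, φ f ∈ Q := fun f => by
      change φ f - ι (π (φ f)) ∈ LinearMap.range φ
      rw [hπφ, map_zero, sub_zero]
      exact ⟨f, rfl⟩
    let S : Submodule k B.carrier :=
      ⨅ x : X, Q.comap ((Finsupp.lsingle x : B.carrier →ₗ[k] X →₀ B.carrier))
    have hS : S = ⊤ := by
      refine V.induction hB S ?_ fun b hb j => ?_
      · refine Submodule.mem_iInf _ |>.2 fun x => ?_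
        change Finsupp.single x 1 - ι (π (Finsupp.single x 1)) ∈ LinearMap.range φ
        have h1 : ι (κ x) = Finsupp.single x 1 := by simpa using hι x 1
        simp [π, h1]
      · rw [Submodule.mem_iInf] at hb ⊢
        intro x
        change Finsupp.single x (b * V.v j) ∈ Q
        rw [← sub_add_cancel (Finsupp.single x (b * V.v j)) (b • ι (V.v j • κ x)), ← hφ1]
        refine add_mem (hQφ _) ?_
        have h2 : b • ι (V.v j • κ x) = ∑ x' ∈ (κ.repr (V.v j • κ x)).support,
            (κ.repr (V.v j • κ x) x') • Finsupp.single x' b := by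
          conv_lhs => rw [← κ.linearCombination_repr (V.v j • κ x)]
          rw [Finsupp.linearCombination_apply, Finsupp.sum, map_sum, Finset.smul_sum]
          refine Finset.sum_congr rfl fun x' _ => ?_
          rw [hι, Finsupp.smul_single, Finsupp.smul_single, smul_eq_mul, Algebra.smul_def,
            Algebra.commutes]
        rw [h2]
        exact Submodule.sum_mem _ fun x' _ => Submodule.smul_mem _ _ (hb x')
    intro f
    have hf : f ∈ Q := by
      rw [← Finsupp.sum_single f]
      refine Submodule.sum_mem _ fun x _ => ?_
      have h3 : f x ∈ S := hS ▸ trivial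
      exact (Submodule.mem_iInf _).1 h3 x
    exact hf
  -- Leading terms: give the part of degree `n` of the coefficient at `j` the weight `n + e j`.
  -- Multiplication by `v_j` yields degree `n + e j`, while `T` stays in degree `n`, which is
  -- smaller. In the top weight only `W` contributes, and `W` is injective; the weight then descends
  -- to zero.
  have hinj : Function.Injective φ := by
    rw [injective_iff_map_eq_zero]
    intro f hf
    have hT : ∀ N, (∀ x j, B.comp N (f x j) = 0) → ∀ x, B.comp N (T f x) = 0 := by
      intro N hN x
      simp only [T, U, Finsupp.lsum_apply, Finsupp.sum, Finsupp.linearCombination_apply,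
        Finsupp.coe_finsetSum, Finset.sum_apply, map_sum]
      refine Finset.sum_eq_zero fun x' _ => Finset.sum_eq_zero fun j _ => ?_
      change B.comp N (f x' j * algebraMap k _ _) = 0
      rw [B.comp_mul_algebraMap, hN, zero_mul]
    have hstep : ∀ N, (∀ n x j, N + 1 ≤ n + V.e j → B.comp n (f x j) = 0) →
        ∀ n x j, N ≤ n + V.e j → B.comp n (f x j) = 0 := by
      intro N hN n x j hn
      rcases eq_or_lt_of_le hn with hn | hn
      · let g : V.J →₀ B.carrier := Finsupp.onFinset (f x).support
          (fun j => if V.e j ≤ N then B.comp (N - V.e j) (f x j) else 0) fun j hj => by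
            rw [Finsupp.mem_support_iff]
            intro h0
            simp [h0] at hj
        have hg : W g = 0 := by
          have h1 : B.comp N (φ f x) = 0 := by rw [hf, Finsupp.zero_apply, map_zero]
          have h2 : φ f x = W (f x) - T f x := rfl
          rw [h2, map_sub, hT N (fun x j => hN N x j (by have := V.e_ne_zero j; omega)), sub_zero]
            at h1
          rw [← h1]
          simp only [W, Finsupp.linearCombination_apply]
          rw [Finsupp.sum_of_support_subset _ Finsupp.support_onFinset_subset _ (by simp),
            Finsupp.sum, map_sum]
          refine Finset.sum_congr rfl fun j _ => ?_
          rw [smul_eq_mul, smul_eq_mul, B.comp_mul_of_mem _ (V.v_mem j), Finsupp.onFinset_apply]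
          split_ifs
          · rfl
          · rw [zero_mul]
        have hg0 : g = 0 := V.injective (hg.trans (map_zero W).symm)
        have h3 := DFunLike.congr_fun hg0 j
        simp only [g, Finsupp.onFinset_apply, Finsupp.zero_apply] at h3
        rw [if_pos (by omega)] at h3
        rwa [show n = N - V.e j by omega]
      · exact hN n x j hn
    have hbound : ∃ N, ∀ n x j, N ≤ n + V.e j → B.comp n (f x j) = 0 := by
      classical
      choose b hb using fun a : B.carrier => B.exists_comp_eq_zero a
      refine ⟨f.support.sup fun x => (f x).support.sup fun j => b (f x j) + V.e j,
        fun n x j hn => ?_⟩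
      by_cases hx : f x j = 0
      · rw [hx, map_zero]
      · have h1 : b (f x j) + V.e j ≤ (f x).support.sup fun j => b (f x j) + V.e j :=
          Finset.le_sup (f := fun j => b (f x j) + V.e j) (Finsupp.mem_support_iff.2 hx)
        have h2 : ((f x).support.sup fun j => b (f x j) + V.e j) ≤
            f.support.sup fun x => (f x).support.sup fun j => b (f x j) + V.e j :=
          Finset.le_sup (f := fun x => (f x).support.sup fun j => b (f x j) + V.e j)
            (Finsupp.mem_support_iff.2 fun h => hx (by rw [h]; rfl))
        exact hb _ _ (by omega)
    obtain ⟨N, hN⟩ := hbound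
    have hall : ∀ n x j, 0 ≤ n + V.e j → B.comp n (f x j) = 0 := by
      induction N with
      | zero => exact hN
      | succ N ih => exact ih (hstep N hN)
    ext x j
    exact B.ext_comp fun n => by rw [hall n x j (Nat.zero_le _)]; simp
  refine ⟨X, π, fun m => ⟨ι m, hπι m⟩, ?_⟩
  have hker : LinearMap.ker π = LinearMap.range φ := by
    ext f
    constructor
    · intro hf
      have := hgen f
      rwa [LinearMap.mem_ker.1 hf, map_zero, sub_zero] at this
    · rintro ⟨g, rfl⟩
      exact hπφ g
  rw [hker]
  exact Module.Projective.of_equiv (LinearEquiv.ofInjective φ hinj)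

end GradedAlg

namespace GradedMod

variable {k : Type u} [Field k] {B : GradedAlg k}

lemma hasProjResolution_one {N F : GradedMod B} (f : Hom F N) (hf : Function.Surjective f.toLin)
    (hF : Module.Projective B.carrier F.carrier)
    (hK : Module.Projective B.carrier (LinearMap.ker f.toLin)) : N.HasProjResolution 1 := by
  let P : ℕ → GradedMod B := fun
    | 0 => F
    | 1 => ker f
    | _ + 2 => zero B
  refine ⟨P, fun
    | 0 => ⟨(LinearMap.ker f.toLin).subtype, fun _ _ h => h⟩
    | _ + 1 => ⟨0, fun _ _ _ => zero_mem _⟩, f, ?_, ?_, hf, ?_, ?_⟩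
  · rintro (_ | _ | i)
    · exact isProjective_iff.2 hF
    · exact isProjective_iff.2 hK
    · exact isProjective_iff.2 (inferInstanceAs (Module.Projective B.carrier PUnit.{u + 1}))
  · rintro (_ | _ | i) hi
    · omega
    · omega
    · exact inferInstanceAs (Subsingleton PUnit.{u + 1})
  · intro x
    exact ⟨fun h => ⟨⟨x, h⟩, rfl⟩, fun ⟨y, hy⟩ => hy ▸ y.2⟩
  · rintro (_ | i) x
    · exact ⟨fun h => ⟨0, (Subtype.ext h).symm⟩, fun ⟨y, hy⟩ => by rw [← hy]; rfl⟩
    · exact ⟨fun _ => ⟨0, Subsingleton.elim (α := PUnit.{u + 1}) _ _⟩, fun _ => rfl⟩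

end GradedMod

/-- A connected graded algebra with projective augmentation ideal has global dimension at most
one. -/
lemma GradedAlg.IsConnected.globalDim_le_one {k : Type u} [Field k] {B : GradedAlg k}
    (hB : B.IsConnected) (h : Module.Projective B.carrier B.augIdeal) : B.globalDim ≤ 1 := by
  obtain ⟨V⟩ := hB.exists_freeGenerators h
  refine iSup_le fun N => ?_
  -- This presentation ignores the grading of `N`; Schanuel's lemma carries projectivity of the
  -- kernel over to a graded free cover.
  obtain ⟨X, π, hπ, hker⟩ := V.exists_presentation hB N.carrier
  obtain ⟨Y, δ, f, hf⟩ := N.exists_free_cover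
  have hF : Module.Projective B.carrier (GradedMod.free B δ).carrier :=
    inferInstanceAs (Module.Projective B.carrier (Y →₀ B.carrier))
  exact iInf₂_le_of_le 1
    (GradedMod.hasProjResolution_one f hf hF (Module.Projective.ker_of_ker π f.toLin hπ hf)) le_rfl

/-! ### The cohomology algebra of a connected DG algebra. -/

namespace DGAlg

variable {k : Type u} [Field k] (A : DGAlg k)

lemma comp_hcls (i : ℕ) (z : A.cocycles) :
    A.cohomology.comp i (A.hcls z) = A.hcls (A.cocyclesComp i z) := by
  obtain ⟨s, hs⟩ := A.exists_sum_comp (z : A.carrier)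
  have hz : z = ∑ j ∈ s, A.cocyclesComp j z := by
    ext
    rw [AddSubmonoidClass.coe_finsetSum]
    exact hs.symm
  conv_lhs => rw [hz]
  conv_rhs => rw [hz]
  simp only [map_sum]
  refine Finset.sum_congr rfl fun j _ => ?_
  have h1 : A.hcls (A.cocyclesComp j z) ∈ A.cohomology.deg j := ⟨_, A.comp_mem j z, rfl⟩
  by_cases h : j = i
  · subst h
    rw [A.cohomology.comp_of_mem h1]
    exact congrArg A.hcls (Subtype.ext (A.comp_of_mem (A.comp_mem j z)).symm)
  · rw [A.cohomology.comp_of_mem_ne h1 h, ← map_zero A.hcls]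
    exact congrArg A.hcls (Subtype.ext (A.comp_of_mem_ne (A.comp_mem j z) h).symm)

lemma hcls_mem_augIdeal {z : A.cocycles} :
    A.hcls z ∈ A.cohomology.augIdeal ↔ A.comp 0 z = 0 := by
  rw [GradedAlg.mem_augIdeal, comp_hcls, hcls_eq_zero_iff]
  constructor
  · rintro ⟨a, ha⟩
    have h1 := A.comp_zero_d a
    rw [ha] at h1
    rwa [← A.comp_of_mem (A.comp_mem 0 (z : A.carrier))]
  · intro h
    exact ⟨0, by rw [map_zero]; exact h.symm⟩

variable {A}

lemma IsConnected.cohomology (hA : A.IsConnected) : A.cohomology.IsConnected := by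
  constructor
  · rw [injective_iff_map_eq_zero]
    intro r hr
    have h1 : A.hcls (algebraMap k A.cocycles r) = 0 := by
      rw [AlgHom.commutes]
      exact congrArg Subtype.val hr
    obtain ⟨a, ha⟩ := A.hcls_eq_zero_iff.1 h1
    have h2 := A.comp_zero_d a
    rw [ha] at h2
    have h3 : (algebraMap k A.carrier r) = 0 :=
      (A.comp_of_mem (A.algebraMap_mem r)).symm.trans h2
    have h4 : algebraMap k (A.deg 0) r = algebraMap k (A.deg 0) 0 := by
      rw [map_zero]
      exact Subtype.ext h3
    exact hA.1 h4
  · rintro ⟨_, z, hz, rfl⟩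
    obtain ⟨r, hr⟩ := GradedAlg.IsConnected.exists_algebraMap_eq hA hz
    refine ⟨r, Subtype.ext ?_⟩
    change algebraMap k A.cohomology.carrier r = _
    rw [← A.hcls.commutes]
    exact congrArg A.hcls (Subtype.ext hr)

lemma comp_zero_sgn (a : A.carrier) : A.comp 0 (A.sgn a) = A.comp 0 a := by
  induction a using DirectSum.Decomposition.inductionOn A.deg with
  | zero => simp
  | add x y hx hy => simp [hx, hy]
  | @homogeneous i a =>
    rw [A.sgn_of_mem a.2, map_smul]
    by_cases h : i = 0
    · subst h
      simp
    · rw [A.comp_of_mem_ne a.2 h, smul_zero]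

end DGAlg

/-! ### Lower bound: resolutions of `k` with two layers. -/

namespace DGMod

variable {k : Type u} [Field k] {A : DGAlg k}

/-- A DG module with a filtration of two steps is, up to isomorphism, obtained by attaching free
generators twice. -/
lemma HasFiltration.exists_two_step {F : DGMod A} (hF : F.HasFiltration 2) :
    ∃ (Y₀ Y₁ : Type u) (e₀ : Y₀ → F.carrier) (e₁ : Y₁ → F.carrier)
      (c : Y₁ → LinearMap.ker (A.finsuppD Y₀)),
      (∀ x, ∃ a b, x = Finsupp.linearCombination A.carrier e₀ a +
        Finsupp.linearCombination A.carrier e₁ b) ∧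
      (∀ a b, Finsupp.linearCombination A.carrier e₀ a +
        Finsupp.linearCombination A.carrier e₁ b = 0 → a = 0 ∧ b = 0) ∧
      ∀ a b, F.d (Finsupp.linearCombination A.carrier e₀ a +
          Finsupp.linearCombination A.carrier e₁ b) =
        Finsupp.linearCombination A.carrier e₀ (A.finsuppD Y₀ a +
          Finsupp.linearCombination A.carrier (fun y => (c y).1) (A.finsuppSgn Y₁ b)) +
        Finsupp.linearCombination A.carrier e₁ (A.finsuppD Y₁ b) := by
  obtain ⟨Φ, hΦ, h2⟩ := hF
  obtain ⟨Y₀, e₀, he₀, -, hd₀, hspan₀, hli₀⟩ := isDGFreeQuotient_iff.1 (hΦ.free 0)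
  obtain ⟨Y₁, e₁, -, -, hd₁, hspan₁, hli₁⟩ := isDGFreeQuotient_iff.1 (hΦ.free 1)
  simp only [zero_add, hΦ.bot, Submodule.mem_bot, sub_eq_zero] at hd₀ hspan₀ hli₀ he₀
  have hmem : ∀ a, Finsupp.linearCombination A.carrier e₀ a ∈ Φ 1 := fun a => by
    rw [Finsupp.linearCombination_apply]
    exact Submodule.sum_mem _ fun y _ => Submodule.smul_mem _ _ (he₀ y)
  have hdl₀ : ∀ a, F.d (Finsupp.linearCombination A.carrier e₀ a) =
      Finsupp.linearCombination A.carrier e₀ (A.finsuppD Y₀ a) := fun a => by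
    rw [F.d_linearCombination, show (fun y => F.d (e₀ y)) = 0 from funext hd₀]
    simp
  -- Freeness of the first layer and `d² = 0` make the coordinates of `d (e₁ y)` a cocycle.
  have hc : ∀ y, ∃ c : LinearMap.ker (A.finsuppD Y₀),
      F.d (e₁ y) = Finsupp.linearCombination A.carrier e₀ c.1 := fun y => by
    obtain ⟨c, hc⟩ := hspan₀ _ (hd₁ y)
    refine ⟨⟨c, hli₀ _ ?_⟩, hc⟩
    rw [← hdl₀, ← hc, F.d_d]
  choose c hc using hc
  refine ⟨Y₀, Y₁, e₀, e₁, c, fun x => ?_, fun a b h => ?_, fun a b => ?_⟩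
  · obtain ⟨b, hb⟩ := hspan₁ x (by rw [h2]; trivial)
    obtain ⟨a, ha⟩ := hspan₀ _ hb
    exact ⟨a, b, by rw [← ha, sub_add_cancel]⟩
  · have hb : b = 0 := hli₁ b (by
      rw [eq_neg_of_add_eq_zero_right h]
      exact neg_mem (hmem a))
    rw [hb, map_zero, add_zero] at h
    exact ⟨hli₀ a h, hb⟩
  · have hlc : ∀ g : Y₁ →₀ A.carrier,
        Finsupp.linearCombination A.carrier (fun y => F.d (e₁ y)) g =
          Finsupp.linearCombination A.carrier e₀
            (Finsupp.linearCombination A.carrier (fun y => (c y).1) g) := fun g => by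
      rw [Finsupp.apply_linearCombination]
      simp only [hc]
      rfl
    rw [map_add, hdl₀, F.d_linearCombination, hlc, map_add]
    abel

/-- Schanuel's lemma for `f` and `h ↦ h • u`, whose kernel is the augmentation ideal. No grading on
`C` is needed, so degree shifts of the trivial module play no role. -/
lemma projective_augIdeal_of_surjective {B : GradedAlg k} {P C : Type*} [AddCommGroup P]
    [AddCommGroup C] [Module B.carrier P] [Module B.carrier C] [Module.Projective B.carrier P]
    (f : P →ₗ[B.carrier] C) (hf : Function.Surjective f)
    (hker : Module.Projective B.carrier (LinearMap.ker f)) (u : C)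
    (hu : ∀ x, ∃ h : B.carrier, h • u = x) (hann : ∀ h : B.carrier, h • u = 0 ↔ h ∈ B.augIdeal) :
    Module.Projective B.carrier B.augIdeal := by
  have h1 : LinearMap.ker (LinearMap.toSpanSingleton B.carrier C u) = B.augIdeal := by
    ext h
    exact hann h
  rw [← h1]
  exact Module.Projective.ker_of_ker f _ hf hu

/-- In the long exact sequence of the two layers, `T` is the connecting map, up to sign conventions,
and `κ` the image of the generator `u` of `H(F) = k` in the cohomology of the top layer. If `κ = 0`,
then `T` is injective and resolves `k`; otherwise `T` is surjective and its kernel is the line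
spanned by `κ`. -/
lemma projective_augIdeal (hA : A.IsConnected) {F : DGMod A} (hF : F.HasFiltration 2)
    (f : Hom F (DGAlg.residue hA)) (hf : f.IsQuasiIso) :
    Module.Projective A.cohomology.carrier A.cohomology.augIdeal := by
  obtain ⟨Y₀, Y₁, e₀, e₁, c, hdec, huniq, hd⟩ := hF.exists_two_step
  rw [Hom.isQuasiIso_iff] at hf
  obtain ⟨hinj, hsurj⟩ := hf
  let l₀ := Finsupp.linearCombination A.carrier e₀
  let l₁ := Finsupp.linearCombination A.carrier e₁
  let lc := Finsupp.linearCombination A.carrier fun y => (c y).1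
  have hd : ∀ a b, F.d (l₀ a + l₁ b) =
      l₀ (A.finsuppD Y₀ a + lc (A.finsuppSgn Y₁ b)) + l₁ (A.finsuppD Y₁ b) := hd
  have huniq' : ∀ a b a' b', l₀ a + l₁ b = l₀ a' + l₁ b' → a = a' ∧ b = b' :=
    fun a b a' b' h => by
      have := huniq (a - a') (b - b') (by
        rw [map_sub, map_sub, sub_add_sub_comm]
        exact sub_eq_zero.2 h)
      exact ⟨sub_eq_zero.1 this.1, sub_eq_zero.1 this.2⟩
  -- the class `u` generating the cohomology of `F`
  let φ : F.carrier → k := f.toLin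
  have hφadd : ∀ x y, φ (x - y) = φ x - φ y := map_sub f.toLin
  have hφsmul : ∀ (a : A.carrier) x, φ (a • x) = DGAlg.augmentation hA a * φ x :=
    map_smul f.toLin
  have hφd : ∀ x, φ (F.d x) = 0 := f.comm
  have hφ0 : ∀ x, F.d x = 0 → φ x = 0 → ∃ y, F.d y = x := fun x hx h =>
    hinj x hx ⟨0, h.symm⟩
  obtain ⟨u, hu, _, hu1⟩ := hsurj (1 : k) rfl
  have hu1 : φ u = 1 := sub_eq_zero.1 hu1.symm
  have hboundary : ∀ x, F.d x = 0 → ∃ y, F.d y = x - φ x • u := fun x hx => by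
    refine hφ0 _ (by rw [map_sub, map_smul, hx, hu, smul_zero, sub_zero]) ?_
    rw [← algebraMap_smul A.carrier, hφadd, hφsmul, DGAlg.augmentation_algebraMap, hu1, mul_one,
      sub_self]
  obtain ⟨a₀, b₀, rfl⟩ := hdec u
  have hu0 := hu
  rw [hd] at hu0
  obtain ⟨hab₀, hDb₀⟩ := huniq _ _ hu0
  have hDσb₀ : A.finsuppD Y₁ (A.finsuppSgn Y₁ b₀) = 0 := by simp [hDb₀]
  let κ := A.finsuppCls Y₁ ⟨_, hDσb₀⟩
  let T : (Y₁ →₀ A.cohomology.carrier) →ₗ[A.cohomology.carrier] (Y₀ →₀ A.cohomology.carrier) :=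
    Finsupp.linearCombination _ fun y => A.finsuppCls Y₀ (c y)
  have hlc : ∀ x, A.finsuppD Y₀ (lc x) = lc (A.finsuppD Y₁ x) := A.finsuppD_linearCombination c
  have hT : ∀ b : LinearMap.ker (A.finsuppD Y₁), ∀ x : LinearMap.ker (A.finsuppD Y₀),
      x.1 = lc b.1 → T (A.finsuppCls Y₁ b) = A.finsuppCls Y₀ x := fun b x hx =>
    (A.finsuppCls_linearCombination c b hx).symm
  have hlc0 : ∀ b : LinearMap.ker (A.finsuppD Y₁), A.finsuppD Y₀ (lc b.1) = 0 := fun b => by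
    rw [hlc, show A.finsuppD Y₁ b.1 = 0 from b.2, map_zero]
  have hκ : T κ = 0 := by
    rw [hT ⟨_, hDσb₀⟩ ⟨_, hlc0 ⟨_, hDσb₀⟩⟩ rfl, A.finsuppCls_eq_zero_iff]
    exact ⟨-a₀, by rw [map_neg, eq_comm]; exact eq_neg_of_add_eq_zero_right hab₀⟩
  have hκ0 : κ = 0 ↔ ∃ g, A.finsuppD Y₁ g = b₀ := by
    rw [A.finsuppCls_eq_zero_iff]
    constructor
    · rintro ⟨g, hg⟩
      have hg : A.finsuppD Y₁ g = A.finsuppSgn Y₁ b₀ := hg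
      exact ⟨-A.finsuppSgn Y₁ g, by
        rw [map_neg, A.finsuppD_finsuppSgn, hg, neg_neg, A.finsuppSgn_finsuppSgn]⟩
    · rintro ⟨g, hg⟩
      exact ⟨-A.finsuppSgn Y₁ g, by rw [map_neg, A.finsuppD_finsuppSgn, hg, neg_neg]⟩
  -- A class killed by `T` lifts to a cocycle of `F`, which is a multiple of `u` modulo boundaries;
  -- its top component gives the claim.
  have hkerT : ∀ x, T x = 0 → ∃ r : k, x = r • κ := fun x hx => by
    obtain ⟨b, rfl⟩ := A.exists_finsuppCls_eq x
    have hDb : A.finsuppD Y₁ b.1 = 0 := b.2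
    rw [hT b ⟨_, hlc0 b⟩ rfl, A.finsuppCls_eq_zero_iff] at hx
    obtain ⟨a, ha⟩ := hx
    have ha : A.finsuppD Y₀ a = lc b.1 := ha
    have hcoc : F.d (l₀ (-a) + l₁ (A.finsuppSgn Y₁ b.1)) = 0 := by
      rw [hd, map_neg, ha, A.finsuppSgn_finsuppSgn, neg_add_cancel, A.finsuppD_finsuppSgn, hDb,
        map_zero, map_zero, neg_zero, map_zero, add_zero]
    obtain ⟨y, hy⟩ := hboundary _ hcoc
    obtain ⟨a₁, b₁, rfl⟩ := hdec y
    set r := φ (l₀ (-a) + l₁ (A.finsuppSgn Y₁ b.1))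
    have hy' : l₀ (-a) + l₁ (A.finsuppSgn Y₁ b.1) - r • (l₀ a₀ + l₁ b₀) =
        l₀ (-a - r • a₀) + l₁ (A.finsuppSgn Y₁ b.1 - r • b₀) := by
      rw [map_sub, map_sub, F.linearCombination_smul_k, F.linearCombination_smul_k, smul_add]
      abel
    rw [hd] at hy
    have hb₁ := (huniq' _ _ _ _ (hy.trans hy')).2
    refine ⟨r, ?_⟩
    rw [← sub_eq_zero, ← map_smul, ← map_sub, A.finsuppCls_eq_zero_iff]
    refine ⟨-A.finsuppSgn Y₁ b₁, ?_⟩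
    rw [map_neg, A.finsuppD_finsuppSgn, neg_neg, hb₁, map_sub, A.finsuppSgn_finsuppSgn, map_smul]
    rfl
  by_cases hκz : κ = 0
  · -- the cohomology of `F` has a free resolution of length one
    obtain ⟨g, hg⟩ := hκ0.1 hκz
    have he₀ : ∀ y, F.d (e₀ y) = 0 := fun y => by
      have := hd (Finsupp.single y 1) 0
      simpa [l₀, l₁, A.d_one] using this
    let ι : (Y₀ →₀ A.cohomology.carrier) →ₗ[A.cohomology.carrier] F.cohomology.carrier :=
      Finsupp.linearCombination _ fun y => F.hcls ⟨e₀ y, he₀ y⟩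
    have hι : ∀ a : LinearMap.ker (A.finsuppD Y₀), ∀ x : LinearMap.ker F.d, x.1 = l₀ a.1 →
        ι (A.finsuppCls Y₀ a) = F.hcls x := fun a x hx =>
      (F.hcls_linearCombination (fun y => ⟨e₀ y, he₀ y⟩) a hx).symm
    have hl₀ : ∀ a : LinearMap.ker (A.finsuppD Y₀), F.d (l₀ a.1) = 0 := fun a => by
      have := hd a.1 0
      rw [show A.finsuppD Y₀ a.1 = 0 from a.2] at this
      simpa using this
    have hgen : ∀ x, ∃ h : A.cohomology.carrier, h • F.hcls ⟨_, hu⟩ = x := fun x => by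
      obtain ⟨⟨x, hx⟩, rfl⟩ := F.hcls_surjective x
      obtain ⟨y, hy⟩ := hboundary x hx
      refine ⟨algebraMap k _ (φ x), ?_⟩
      rw [algebraMap_smul, eq_comm, ← sub_eq_zero, ← map_smul, ← map_sub, F.hcls_eq_zero_iff]
      exact ⟨y, hy⟩
    have hιT : LinearMap.ker ι = LinearMap.range T := by
      ext x
      constructor
      · intro hx
        obtain ⟨a, rfl⟩ := A.exists_finsuppCls_eq x
        rw [LinearMap.mem_ker, hι a ⟨_, hl₀ a⟩ rfl, F.hcls_eq_zero_iff] at hx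
        obtain ⟨y, hy⟩ := hx
        obtain ⟨a₁, b₁, rfl⟩ := hdec y
        rw [hd] at hy
        obtain ⟨h1, h2⟩ := huniq' _ _ a.1 0 (hy.trans (by simp))
        have hDσ : A.finsuppD Y₁ (A.finsuppSgn Y₁ b₁) = 0 := by simp [h2]
        refine ⟨A.finsuppCls Y₁ ⟨_, hDσ⟩, ?_⟩
        rw [hT ⟨_, hDσ⟩ ⟨_, hlc0 ⟨_, hDσ⟩⟩ rfl, ← sub_eq_zero, ← map_sub,
          A.finsuppCls_eq_zero_iff]
        refine ⟨-a₁, ?_⟩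
        change _ = lc _ - a.1
        rw [← h1, map_neg]
        abel
      · rintro ⟨x, rfl⟩
        obtain ⟨b, rfl⟩ := A.exists_finsuppCls_eq x
        have hDb : A.finsuppD Y₁ b.1 = 0 := b.2
        rw [LinearMap.mem_ker, hT b ⟨_, hlc0 b⟩ rfl, hι ⟨_, hlc0 b⟩ ⟨_, hl₀ ⟨_, hlc0 b⟩⟩ rfl,
          F.hcls_eq_zero_iff]
        refine ⟨l₀ 0 + l₁ (A.finsuppSgn Y₁ b.1), ?_⟩
        rw [hd]
        simp [hDb]
    have hTinj : Function.Injective T := by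
      rw [injective_iff_map_eq_zero]
      intro x hx
      obtain ⟨r, rfl⟩ := hkerT x hx
      rw [hκz, smul_zero]
    refine projective_augIdeal_of_surjective ι ?_ ?_ (F.hcls ⟨_, hu⟩) hgen ?_
    · intro x
      obtain ⟨h, rfl⟩ := hgen x
      -- As `b₀` is the boundary of `g`, subtracting `d (l₁ g)` moves `u` into the first layer.
      have hcoc : A.finsuppD Y₀ (a₀ - lc (A.finsuppSgn Y₁ g)) = 0 := by
        rw [map_sub, hlc, A.finsuppD_finsuppSgn, hg, map_neg, sub_neg_eq_add]
        exact hab₀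
      refine ⟨h • A.finsuppCls Y₀ ⟨_, hcoc⟩, ?_⟩
      rw [map_smul]
      congr 1
      rw [hι ⟨_, hcoc⟩ ⟨_, hl₀ ⟨_, hcoc⟩⟩ rfl, eq_comm, ← sub_eq_zero, ← map_sub,
        F.hcls_eq_zero_iff]
      refine ⟨l₀ 0 + l₁ g, ?_⟩
      rw [hd, hg]
      change _ = l₀ a₀ + l₁ b₀ - l₀ _
      simp only [map_sub, map_zero, zero_add]
      abel
    · rw [hιT]
      exact Module.Projective.of_equiv (LinearEquiv.ofInjective T hTinj)
    · intro h
      obtain ⟨z, rfl⟩ := A.hcls_surjective h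
      rw [A.hcls_mem_augIdeal, F.hcls_smul_hcls, F.hcls_eq_zero_iff,
        ← DGAlg.augmentation_eq_zero_iff hA]
      have h1 : φ ((z : A.carrier) • (l₀ a₀ + l₁ b₀)) = DGAlg.augmentation hA z := by
        rw [hφsmul, hu1, mul_one]
      constructor
      · rintro ⟨y, hy⟩
        rw [← h1, ← hφd y, hy]
        rfl
      · intro h0
        exact hφ0 _ (F.cocycleAct z ⟨_, hu⟩).2 (h1.trans h0)
  · -- the trivial module is a direct summand of a free module
    have hTsurj : Function.Surjective T := by
      rw [← LinearMap.range_eq_top, eq_top_iff]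
      intro x _
      rw [← Finsupp.sum_single x]
      refine Submodule.sum_mem _ fun y _ => ?_
      rw [← mul_one (x y), ← smul_eq_mul, ← Finsupp.smul_single]
      refine Submodule.smul_mem _ _ ?_
      have hy1 : A.finsuppD Y₀ (Finsupp.single y 1) = 0 := by simp [A.d_one]
      have hcoc : F.d (l₀ (Finsupp.single y 1) + l₁ 0) = 0 := by
        rw [hd, hy1]
        simp
      obtain ⟨w, hw⟩ := hboundary _ hcoc
      obtain ⟨a₁, b₁, rfl⟩ := hdec w
      set r := φ (l₀ (Finsupp.single y 1) + l₁ 0)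
      have hw' : l₀ (Finsupp.single y 1) + l₁ 0 - r • (l₀ a₀ + l₁ b₀) =
          l₀ (Finsupp.single y 1 - r • a₀) + l₁ (-(r • b₀)) := by
        rw [map_sub, map_neg, F.linearCombination_smul_k, F.linearCombination_smul_k, smul_add,
          map_zero]
        abel
      rw [hd] at hw
      obtain ⟨h1, h2⟩ := huniq' _ _ _ _ (hw.trans hw')
      -- The top components give `d b₁ = -r b₀`, so `r ≠ 0` would make `b₀` a boundary and `κ` zero.
      -- Hence the basis cocycle at `y` is itself a boundary in `F`, that is, its class is in the
      -- range of `T`.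
      have hr : r = 0 := by
        by_contra hr
        refine hκz (hκ0.2 ⟨-(r⁻¹ • b₁), ?_⟩)
        rw [map_neg, map_smul, h2, smul_neg, neg_neg, smul_smul, inv_mul_cancel₀ hr, one_smul]
      rw [hr, zero_smul, sub_zero] at h1
      rw [hr, zero_smul, neg_zero] at h2
      have hDσ : A.finsuppD Y₁ (A.finsuppSgn Y₁ b₁) = 0 := by simp [h2]
      refine ⟨A.finsuppCls Y₁ ⟨_, hDσ⟩, ?_⟩
      rw [hT ⟨_, hDσ⟩ ⟨_, hlc0 ⟨_, hDσ⟩⟩ rfl,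
        ← A.finsuppCls_single_one (x := ⟨_, hy1⟩) rfl, ← sub_eq_zero, ← map_sub,
        A.finsuppCls_eq_zero_iff]
      refine ⟨-a₁, ?_⟩
      change _ = lc _ - Finsupp.single y 1
      rw [← h1, map_neg]
      abel
    have hbot : ∀ (P : Type u) [AddCommGroup P] [Module A.cohomology.carrier P],
        Module.Projective A.cohomology.carrier
          (LinearMap.ker (LinearMap.id : P →ₗ[A.cohomology.carrier] P)) := fun P _ _ => by
      rw [LinearMap.ker_id]
      infer_instance
    have := hbot (Y₀ →₀ A.cohomology.carrier)
    -- Schanuel's lemma against the identity, whose kernel is zero: a surjection onto a free module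
    -- splits.
    have hker : Module.Projective A.cohomology.carrier (LinearMap.ker T) :=
      Module.Projective.ker_of_ker LinearMap.id T Function.surjective_id hTsurj
    refine projective_augIdeal_of_surjective (B := A.cohomology) (P := LinearMap.ker T)
      (C := LinearMap.ker T) LinearMap.id
      Function.surjective_id (hbot _) ⟨κ, hκ⟩ ?_ ?_
    · rintro ⟨x, hx⟩
      obtain ⟨r, rfl⟩ := hkerT x hx
      exact ⟨algebraMap k _ r, Subtype.ext (algebraMap_smul _ _ _)⟩
    · have hm : ∀ h ∈ A.cohomology.augIdeal, h • κ = 0 := fun h hh => by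
        obtain ⟨z, rfl⟩ := A.hcls_surjective h
        rw [A.hcls_mem_augIdeal] at hh
        have hz0 : A.d z = 0 := z.2
        have hz : A.d (A.sgn z) = 0 := by simp [hz0]
        -- Since `κ` is represented by `sgn b₀`, the action of `z` on `κ` corresponds to that of
        -- `sgn z` on `u`: `z * sgn b = sgn (sgn z * b)`.
        obtain ⟨w, hw⟩ := hφ0 _ (F.cocycleAct ⟨A.sgn z, hz⟩ ⟨_, hu⟩).2 (by
          change φ (A.sgn z • (l₀ a₀ + l₁ b₀)) = 0
          rw [hφsmul, (DGAlg.augmentation_eq_zero_iff hA _).2, zero_mul]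
          rw [DGAlg.comp_zero_sgn, hh])
        obtain ⟨a₁, b₁, rfl⟩ := hdec w
        have hw : _ = A.sgn z • (l₀ a₀ + l₁ b₀) := hw
        rw [hd, smul_add, ← map_smul, ← map_smul] at hw
        have h2 := (huniq' _ _ _ _ hw).2
        ext j
        change A.hcls z * κ j = 0
        rw [DGAlg.finsuppCls_apply, ← map_mul, A.hcls_eq_zero_iff]
        refine ⟨-A.sgn (b₁ j), ?_⟩
        have h3 := DFunLike.congr_fun h2 j
        rw [A.finsuppD_apply] at h3
        rw [map_neg, A.d_sgn, neg_neg, h3]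
        simp [A.sgn_mul]
      intro h
      refine ⟨fun h0 => ?_, fun hh => Subtype.ext (hm h hh)⟩
      have h0 : h • κ = 0 := congrArg Subtype.val h0
      -- Split `h` into a scalar `r` and an element of the augmentation ideal. Only the scalar acts
      -- on `κ`, so `r • κ = 0` and `r = 0`.
      obtain ⟨r, hr⟩ := hA.cohomology.exists_algebraMap_eq (A.cohomology.comp_mem 0 h)
      have h1 : h - algebraMap k _ r ∈ A.cohomology.augIdeal := by
        rw [GradedAlg.mem_augIdeal, hr, map_sub,
          A.cohomology.comp_of_mem (A.cohomology.comp_mem 0 h), sub_self]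
      have h2 := hm _ h1
      rw [sub_smul, h0, zero_sub, neg_eq_zero, algebraMap_smul] at h2
      rcases smul_eq_zero.1 h2 with hr0 | hκ'
      · rw [GradedAlg.mem_augIdeal, ← hr, hr0, map_zero]
      · exact absurd hκ' hκz

end DGMod

theorem propositionB {k : Type u} [Field k] (A : DGAlg k) (hA : A.IsConnected)
    (h : A.cohomology.globalDim = 2) :
    A.leftGlobalDim = 2 ∧ (DGAlg.residue hA).coneLength = 2 := by
  have hle : ∀ M : DGMod A, M.coneLength ≤ 2 := fun M =>
    M.coneLength_le_two (h ▸ le_iSup (fun N : GradedMod A.cohomology => N.projDim) M.cohomology)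
  have hge : 2 ≤ (DGAlg.residue hA).coneLength := by
    by_contra! hlt
    simp only [DGMod.coneLength, DGMod.dgFreeClass, iInf_lt_iff] at hlt
    obtain ⟨F, ⟨-, f, hf⟩, n, ⟨Φ, hΦ, -, hn, -⟩, hlt⟩ := hlt
    have hn2 : n < 2 := by exact_mod_cast hlt
    -- Length at most one means at most two layers, as `Φ (n + 1)` is `F(n)`.
    have hF : F.HasFiltration 2 := ⟨Φ, hΦ, eq_top_iff.2 (hn ▸ hΦ.mono (by omega))⟩
    have h1 := hA.cohomology.globalDim_le_one (DGMod.projective_augIdeal hA hF f hf)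
    rw [h] at h1
    exact absurd h1 (by norm_num)
  have hk := le_antisymm (hle _) hge
  exact ⟨le_antisymm (iSup_le hle) (hge.trans (le_iSup (fun M : DGMod A => M.coneLength) _)), hk⟩
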